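/- **Setting.** Let $d\ge 1$, $\beta>0$, and let $\phi:\mathbb R^d\to\mathbb R\cup\{\infty\}$ be Borel measurable with $\phi(-x)=\phi(x)\in\mathbb R$ for $x\ne 0$. Assume: - (RP) There are a decreasing continuous $\Phi:(0,\infty)\to[0,\infty)$ with $\lim_{t\to0}\Phi(t)t^d=\infty$ and $R_1>0$ such that $\phi(x)\ge\Phi(|x|)$ for $0<|x|\le R_1$, and $\phi$ is bounded from above on $\{r\le|x|\le R_1\}$ for every $r>0$. - (T) There are $A,R_2<\infty$, $R_2>0$, and $\lambda>d$ with $|\phi(x)|\le A|x|^{-\lambda}$ for $|x|\ge R_2$. - (BB) There is $B\ge 0$ with $\phi\ge -B$ on $\mathbb R^d$. - (D) $e^{-\beta\phi}$ is weakly differentiable on $\mathbb R^d$, $\phi\in C^1(\mathbb R^d\setminus\{0\})$, $\nabla\phi\in L^p(\mathbb R^d,e^{-\beta\phi}dx)$ for $p=1,2,3$, and $\Phi$ in (RP) can be chosen differentiable and such that $\Phi'e^{-a\Phi}$ is bounded on $(0,\infty)$ for every $a>0$. Let $(\Lambda_N)_{N\ge1}$ be bounded Borel subsets of $\mathbb R^d$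 with Lebesgue measure $|\Lambda_N|>0$ such that every bounded set is contained in $\Lambda_N$ for all large $N$, such that $N/|\Lambda_N|\to\rho$ for some $\rho\in(0,\infty)$, and such that $(\Lambda_N)^N\subset\mathbb R^{Nd}$ is the closure of an open, relatively compact set, with boundary of Lebesgue measure zero. Let $\Gamma$ be the space of locally finite subsets of $\mathbb R^d$ with the vague topology (the coarsest topology making $\gamma\mapsto\langle f,\gamma\rangle:=\sum_{x\in\gamma}f(x)$ continuous for all $f\in C_c(\mathbb R^d)$) and its Borel $\sigma$-algebra. On $(\Lambda_N)^N$ let $$\mu_{\Lambda_N,N}=\frac1Z\exp\Big(-\beta\sum_{1\le i<j\le N}\phi(x_i-x_j)\Big)\,dx_1\cdots dx_N,$$ where $Z$ is the normalizing constant, and let $\mu^{(N)}$ be its image on $\Gamma$ under $\mathrm{sym}^{(N)}(x_1,\dots,x_N)=\{x_1,\dots,x_N\}$ (defined almost everywhere). Let $(\mathcal E_{\Lambda_N,N},D(\mathcal E_{\Lambda_N,N}))$ be the closure on $L^2(\mu_{\Lambda_N,N})$ of the form $\sum_{i=1}^N\int(\nabla_iu,\nabla_iv)\,d\mu_{\Lambda_N,N}$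 defined for $u,v\in C((\Lambda_N)^N)$ whose distributional gradients $\nabla_i$ on the interior of $(\Lambda_N)^N$ are locally integrable and lie in $L^2(\mu_{\Lambda_N,N})$. The finite-volume Dirichlet form is its image under $\mathrm{sym}^{(N)}$: $$\mathcal E^{(N)}_{\Lambda_N}(F,G)=\mathcal E_{\Lambda_N,N}(F\circ\mathrm{sym}^{(N)},G\circ\mathrm{sym}^{(N)}),$$ with domain $D(\mathcal E^{(N)}_{\Lambda_N})=\{F\in L^2(\mu^{(N)}): F\circ\mathrm{sym}^{(N)}\in D(\mathcal E_{\Lambda_N,N})\}$. Let $\mathcal FC_b^\infty(\mathcal D,\Gamma)$ be the set of functions $F(\gamma)=g_F(\langle f_1,\gamma\rangle,\dots,\langle f_n,\gamma\rangle)$ with $n\in\mathbb N$, $f_j\in C_c^\infty(\mathbb R^d)$ and $g_F\in C^\infty(\mathbb R^n)$ bounded together with all its derivatives. For such $F$ put $$\nabla^\Gamma F(\gamma,x)=\sum_{j=1}^n\partial_jg_F(\langle f_1,\gamma\rangle,\dots,\langle f_n,\gamma\rangle)\,\nabla f_j(x).$$ For a probability measure $\mu$ on $\Gamma$ put $$\mathcal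 E_\mu(F,G)=\int_\Gamma\sum_{x\in\gamma}(\nabla^\Gamma F(\gamma,x),\nabla^\Gamma G(\gamma,x))_{\mathbb R^d}\,d\mu(\gamma).$$ **Proposition.** Let $(\mu^{(N_n)})_{n}$, with $1\le N_1<N_2<\cdots$, be a subsequence of $(\mu^{(N)})_{N\ge 1}$ converging weakly to a probability measure $\mu$ on $\Gamma$. Then for all $F,G\in\mathcal FC_b^\infty(\mathcal D,\Gamma)$: $F,G\in D(\mathcal E^{(N_n)}_{\Lambda_{N_n}})$ for every $n$, the integral defining $\mathcal E_\mu(F,G)$ converges absolutely, and $$\lim_{n\to\infty}\mathcal E^{(N_n)}_{\Lambda_{N_n}}(F,G)=\mathcal E_\mu(F,G).$$ -/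

import Mathlib

open MeasureTheory Filter Topology
open scoped ENNReal ContDiff

noncomputable section

namespace NVLimit

/-- Euclidean space `ℝ^d`. -/
abbrev Space (d : ℕ) : Type := EuclideanSpace ℝ (Fin d)

/-! ### The configuration space -/

/-- The configuration space `Γ`: locally finite subsets of `ℝ^d`. -/
@[ext]
structure Config (d : ℕ) : Type where
  /-- The underlying set of points. -/
  points : Set (Space d)
  locallyFinite : ∀ K : Set (Space d), IsCompact K → (points ∩ K).Finite

/-- `⟨f, γ⟩ = ∑_{x ∈ γ} f(x)`; the sum is finite for compactly supported `f`. -/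
def pairing {d : ℕ} (f : Space d → ℝ) (γ : Config d) : ℝ :=
  ∑ᶠ x ∈ γ.points, f x

/-- The vague topology on `Γ`: the coarsest one for which `γ ↦ ⟨f, γ⟩` is continuous for every
continuous, compactly supported `f`. -/
instance instTopologicalSpaceConfig (d : ℕ) : TopologicalSpace (Config d) :=
  ⨅ f : {f : Space d → ℝ // Continuous f ∧ HasCompactSupport f},
    TopologicalSpace.induced (pairing f.1) inferInstance

/-- The Borel `σ`-algebra of the vague topology. -/
instance instMeasurableSpaceConfig (d : ℕ) : MeasurableSpace (Config d) := borel (Config d)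

instance instBorelSpaceConfig (d : ℕ) : BorelSpace (Config d) := ⟨rfl⟩

/-- Weak convergence of measures on `Γ`: convergence of the integrals of all bounded continuous
functions. -/
def ConvergesWeakly {d : ℕ} (ν : ℕ → Measure (Config d)) (μ : Measure (Config d)) : Prop :=
  ∀ f : BoundedContinuousFunction (Config d) ℝ,
    Tendsto (fun n => ∫ γ, f γ ∂(ν n)) atTop (𝓝 (∫ γ, f γ ∂μ))

/-! ### Weak gradients -/

/-- `V` is the weak gradient on the open set `U ⊆ X` of the function `u`, with respect to the
directions `L h`, `h ∈ ℝ^d`. With `X = ℝ^d` and `L` the identity this is the weak gradient `∇u`;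
with `X = (ℝ^d)^N` and `L` the inclusion of the `i`-th factor it is the weak gradient `∇ᵢu` in the
`i`-th variable. -/
structure HasWeakGradientAlong {d : ℕ} {X : Type} [NormedAddCommGroup X] [NormedSpace ℝ X]
    [MeasureSpace X] (L : Space d →ₗ[ℝ] X) (U : Set X) (u : X → ℝ) (V : X → Space d) : Prop where
  locallyIntegrable : LocallyIntegrableOn u U
  locallyIntegrable_grad : LocallyIntegrableOn V U
  integral_eq : ∀ ψ : X → ℝ, ContDiff ℝ ∞ ψ → HasCompactSupport ψ → tsupport ψ ⊆ U →
    ∀ h : Space d, ∫ x in U, u x * fderiv ℝ ψ x (L h) = -∫ x in U, inner ℝ (V x) h * ψ x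

/-! ### Pair potentials -/

/-- A pair potential (without hard core) `φ : ℝ^d → ℝ ∪ {∞}`. -/
structure IsPairPotential {d : ℕ} (φ : Space d → EReal) : Prop where
  measurable : Measurable φ
  ne_bot : ∀ x, φ x ≠ ⊥
  ne_top : ∀ x, x ≠ 0 → φ x ≠ ⊤
  even : ∀ x, φ (-x) = φ x

/-- `Φ : (0, ∞) → [0, ∞)` is a function as required by the repulsion condition for `φ`. -/
structure IsRepulsionBound {d : ℕ} (φ : Space d → EReal) (Φ : ℝ → ℝ) : Prop where
  nonneg : ∀ t, 0 < t → 0 ≤ Φ t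
  antitone : AntitoneOn Φ (Set.Ioi 0)
  continuous : ContinuousOn Φ (Set.Ioi 0)
  tendsto : Tendsto (fun t => Φ t * t ^ d) (𝓝[>] 0) atTop
  bounds : ∃ R₁ : ℝ, 0 < R₁ ∧
    (∀ x : Space d, x ≠ 0 → ‖x‖ ≤ R₁ → ((Φ ‖x‖ : ℝ) : EReal) ≤ φ x) ∧
    ∀ r : ℝ, 0 < r → ∃ M : ℝ, ∀ x : Space d, r ≤ ‖x‖ → ‖x‖ ≤ R₁ → φ x ≤ (M : EReal)

/-- (RP) Repulsion. -/
def Repulsive {d : ℕ} (φ : Space d → EReal) : Prop := ∃ Φ : ℝ → ℝ, IsRepulsionBound φ Φ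

/-- (T) Temperedness. -/
def Tempered {d : ℕ} (φ : Space d → EReal) : Prop :=
  ∃ A R₂ l : ℝ, 0 < R₂ ∧ (d : ℝ) < l ∧
    ∀ x : Space d, R₂ ≤ ‖x‖ → |(φ x).toReal| ≤ A * ‖x‖ ^ (-l)

/-- (BB) Boundedness from below. -/
def BoundedFromBelow {d : ℕ} (φ : Space d → EReal) : Prop :=
  ∃ B : ℝ, 0 ≤ B ∧ ∀ x, ((-B : ℝ) : EReal) ≤ φ x

/-- The function `exp(-β φ)`. The potential is finite off the origin, so passing to real values
can alter it only at the origin, a null set in dimension `d ≥ 1`. -/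
def boltzmann {d : ℕ} (β : ℝ) (φ : Space d → EReal) (x : Space d) : ℝ :=
  Real.exp (-(β * (φ x).toReal))

/-- (D) Differentiability, at inverse temperature `β`. -/
structure IsDifferentiablePotential {d : ℕ} (β : ℝ) (φ : Space d → EReal) : Prop where
  weaklyDifferentiable : ∃ V : Space d → Space d,
    HasWeakGradientAlong LinearMap.id Set.univ (boltzmann β φ) V
  contDiffOn : ContDiffOn ℝ 1 (fun x => (φ x).toReal) {0}ᶜ
  memLp : ∀ p ∈ ({1, 2, 3} : Set ℝ≥0∞), MemLp (gradient (fun x => (φ x).toReal)) p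
    (volume.withDensity fun x => ENNReal.ofReal (boltzmann β φ x))
  repulsion : ∃ Φ : ℝ → ℝ, IsRepulsionBound φ Φ ∧ DifferentiableOn ℝ Φ (Set.Ioi 0) ∧
    ∀ a : ℝ, 0 < a → ∃ M : ℝ, ∀ t, 0 < t → |deriv Φ t * Real.exp (-(a * Φ t))| ≤ M

/-! ### Volumes -/

/-- The set `Λ^N ⊆ (ℝ^d)^N`. -/
def box {d : ℕ} (Λ : Set (Space d)) (N : ℕ) : Set (Fin N → Space d) :=
  Set.univ.pi fun _ => Λ

/-- `(Λ_N)_{N ≥ 1}` is a sequence of volumes corresponding to the density `ρ > 0`. -/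
structure IsVolumeSequence {d : ℕ} (ρ : ℝ) (Λ : ℕ → Set (Space d)) : Prop where
  density_pos : 0 < ρ
  bounded : ∀ N, 1 ≤ N → Bornology.IsBounded (Λ N)
  measurableSet : ∀ N, 1 ≤ N → MeasurableSet (Λ N)
  volume_pos : ∀ N, 1 ≤ N → 0 < volume (Λ N)
  exhausts : ∀ S : Set (Space d), Bornology.IsBounded S → ∃ N₀ : ℕ, ∀ N, N₀ ≤ N → S ⊆ Λ N
  tendsto : Tendsto (fun N : ℕ => (N : ℝ) / (volume (Λ N)).toReal) atTop (𝓝 ρ)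

/-- `Λ^N` is the closure of an open, relatively compact set and its boundary is a Lebesgue null
set. -/
structure IsRegularVolume {d : ℕ} (Λ : Set (Space d)) (N : ℕ) : Prop where
  closure_open : ∃ O : Set (Fin N → Space d),
    IsOpen O ∧ IsCompact (closure O) ∧ box Λ N = closure O
  frontier_null : volume (frontier (box Λ N)) = 0

/-! ### Canonical Gibbs measures -/

/-- The energy `∑_{i < j} φ(xᵢ - xⱼ)`. -/
def energy {d N : ℕ} (φ : Space d → EReal) (x : Fin N → Space d) : ℝ :=
  ∑ i : Fin N, ∑ j ∈ Finset.Ioi i, (φ (x i - x j)).toReal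

/-- The canonical partition function `∫_{Λ^N} exp(-β ∑_{i < j} φ(xᵢ - xⱼ)) dx`. -/
def partitionFunction {d : ℕ} (β : ℝ) (φ : Space d → EReal) (Λ : Set (Space d)) (N : ℕ) : ℝ≥0∞ :=
  ∫⁻ x in box Λ N, ENNReal.ofReal (Real.exp (-(β * energy φ x)))

/-- The probability measure `μ_{Λ,N}` on `Λ^N` with density proportional to
`exp(-β ∑_{i < j} φ(xᵢ - xⱼ))`. -/
def tupleGibbs {d : ℕ} (β : ℝ) (φ : Space d → EReal) (Λ : Set (Space d)) (N : ℕ) :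
    Measure (Fin N → Space d) :=
  (partitionFunction β φ Λ N)⁻¹ • (volume.restrict (box Λ N)).withDensity
    fun x => ENNReal.ofReal (Real.exp (-(β * energy φ x)))

/-- The map `(x₁, …, x_N) ↦ {x₁, …, x_N}`. -/
def sym {d N : ℕ} (x : Fin N → Space d) : Config d where
  points := Set.range x
  locallyFinite := fun K _ => (Set.finite_range x).inter_of_left K

/-- The canonical `N`-particle Gibbs measure `μ_Λ^{(N)}` in `Λ` with empty boundary condition, as
a measure on `Γ`: the image of `μ_{Λ,N}` under `sym`. (Tuples with coinciding entries form a null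
set.) -/
def canonicalGibbs {d : ℕ} (β : ℝ) (φ : Space d → EReal) (Λ : Set (Space d)) (N : ℕ) :
    Measure (Config d) :=
  (tupleGibbs β φ Λ N).map sym

/-! ### The finite volume Dirichlet form -/

/-- `u` belongs to the initial domain of the form on `Λ^N`, and `V i` is its distributional
gradient `∇ᵢu` on the interior of `Λ^N`: `u` is continuous on `Λ^N` and the `∇ᵢu` are locally
integrable on the interior and belong to `L²(μ_{Λ,N})`. -/
structure IsCoreGradient {d : ℕ} (β : ℝ) (φ : Space d → EReal) (Λ : Set (Space d)) (N : ℕ)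
    (u : (Fin N → Space d) → ℝ) (V : Fin N → (Fin N → Space d) → Space d) : Prop where
  continuousOn : ContinuousOn u (box Λ N)
  weakGradient : ∀ i, HasWeakGradientAlong (LinearMap.single ℝ (fun _ : Fin N => Space d) i)
    (interior (box Λ N)) u (V i)
  memLp : ∀ i, MemLp (V i) 2 (tupleGibbs β φ Λ N)

/-- `u` belongs to the domain of the closure of the form
`ℰ_{Λ,N}(u, v) = ∑ᵢ ∫ (∇ᵢu, ∇ᵢv) dμ_{Λ,N}`, and `V i` is its gradient `∇ᵢu`: there are `u k` in the
initial domain with `u k → u` and `∇ᵢ(u k) → V i` in `L²(μ_{Λ,N})`. As `L²(μ_{Λ,N})` is complete,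
the existence of `V` says that the `u k` can be chosen to converge to `u` in `L²(μ_{Λ,N})` and to be
Cauchy for the form. -/
structure IsClosedGradient {d : ℕ} (β : ℝ) (φ : Space d → EReal) (Λ : Set (Space d)) (N : ℕ)
    (u : (Fin N → Space d) → ℝ) (V : Fin N → (Fin N → Space d) → Space d) : Prop where
  memLp : MemLp u 2 (tupleGibbs β φ Λ N)
  memLp_grad : ∀ i, MemLp (V i) 2 (tupleGibbs β φ Λ N)
  approx : ∃ (w : ℕ → (Fin N → Space d) → ℝ) (W : ℕ → Fin N → (Fin N → Space d) → Space d),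
    (∀ k, IsCoreGradient β φ Λ N (w k) (W k)) ∧
    Tendsto (fun k => eLpNorm (w k - u) 2 (tupleGibbs β φ Λ N)) atTop (𝓝 0) ∧
    ∀ i, Tendsto (fun k => eLpNorm (W k i - V i) 2 (tupleGibbs β φ Λ N)) atTop (𝓝 0)

/-- The domain `D(ℰ_{Λ,N})` of the closed form on `L²(μ_{Λ,N})`. -/
def TupleFormDomain {d : ℕ} (β : ℝ) (φ : Space d → EReal) (Λ : Set (Space d)) (N : ℕ)
    (u : (Fin N → Space d) → ℝ) : Prop :=
  ∃ V, IsClosedGradient β φ Λ N u V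

open Classical in
/-- The gradients `∇ᵢu` of `u ∈ D(ℰ_{Λ,N})` (and `0` outside the domain). -/
def closedGradient {d : ℕ} (β : ℝ) (φ : Space d → EReal) (Λ : Set (Space d)) (N : ℕ)
    (u : (Fin N → Space d) → ℝ) : Fin N → (Fin N → Space d) → Space d :=
  if h : TupleFormDomain β φ Λ N u then h.choose else 0

/-- The closed form `ℰ_{Λ,N}(u, v) = ∑ᵢ ∫ (∇ᵢu, ∇ᵢv) dμ_{Λ,N}`. -/
def tupleForm {d : ℕ} (β : ℝ) (φ : Space d → EReal) (Λ : Set (Space d)) (N : ℕ)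
    (u v : (Fin N → Space d) → ℝ) : ℝ :=
  ∑ i : Fin N, ∫ x, inner ℝ (closedGradient β φ Λ N u i x) (closedGradient β φ Λ N v i x)
    ∂(tupleGibbs β φ Λ N)

/-- The domain `D(ℰ_Λ^{(N)})` of the image form under `sym`. -/
def FiniteVolumeDomain {d : ℕ} (β : ℝ) (φ : Space d → EReal) (Λ : Set (Space d)) (N : ℕ)
    (F : Config d → ℝ) : Prop :=
  MemLp F 2 (canonicalGibbs β φ Λ N) ∧ TupleFormDomain β φ Λ N (F ∘ sym)

/-- The finite volume Dirichlet form `ℰ_Λ^{(N)}(F, G) = ℰ_{Λ,N}(F ∘ sym, G ∘ sym)`. -/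
def finiteVolumeForm {d : ℕ} (β : ℝ) (φ : Space d → EReal) (Λ : Set (Space d)) (N : ℕ)
    (F G : Config d → ℝ) : ℝ :=
  tupleForm β φ Λ N (F ∘ sym) (G ∘ sym)

/-! ### Smooth cylinder functions and the infinite volume form -/

/-- Data of a finitely based smooth cylinder function
`F(γ) = g(⟨f₁, γ⟩, …, ⟨fₙ, γ⟩)`, with `fⱼ ∈ C_c^∞(ℝ^d)` and `g ∈ C_b^∞(ℝⁿ)`, i.e. `g` is smooth and
bounded together with all its derivatives. -/
structure CylinderFunction (d : ℕ) : Type where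
  n : ℕ
  f : Fin n → Space d → ℝ
  g : (Fin n → ℝ) → ℝ
  contDiff_f : ∀ j, ContDiff ℝ ∞ (f j)
  hasCompactSupport_f : ∀ j, HasCompactSupport (f j)
  contDiff_g : ContDiff ℝ ∞ g
  bounded_g : ∀ k : ℕ, ∃ C : ℝ, ∀ y, ‖iteratedFDeriv ℝ k g y‖ ≤ C

/-- The function `γ ↦ g(⟨f₁, γ⟩, …, ⟨fₙ, γ⟩)`. -/
def CylinderFunction.toFun {d : ℕ} (F : CylinderFunction d) (γ : Config d) : ℝ :=
  F.g fun j => pairing (F.f j) γ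

/-- The gradient `(∇^Γ F)(γ, x) = ∑ⱼ ∂ⱼg(⟨f₁, γ⟩, …, ⟨fₙ, γ⟩) ∇fⱼ(x)`. -/
def CylinderFunction.grad {d : ℕ} (F : CylinderFunction d) (γ : Config d) (x : Space d) :
    Space d :=
  ∑ j : Fin F.n,
    fderiv ℝ F.g (fun k => pairing (F.f k) γ) (Pi.single j 1) • gradient (F.f j) x

/-- The scalar product
`⟨∇^Γ F(γ), ∇^Γ G(γ)⟩_{T_γ Γ} = ∑_{x ∈ γ} (∇^Γ F(γ, x), ∇^Γ G(γ, x))`. -/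
def squareField {d : ℕ} (F G : CylinderFunction d) (γ : Config d) : ℝ :=
  pairing (fun x => inner ℝ (F.grad γ x) (G.grad γ x)) γ

/-- The form `ℰ_μ(F, G) = ∫_Γ ⟨∇^Γ F(γ), ∇^Γ G(γ)⟩_{T_γ Γ} μ(dγ)`. -/
def infiniteVolumeForm {d : ℕ} (μ : Measure (Config d)) (F G : CylinderFunction d) : ℝ :=
  ∫ γ, squareField F G γ ∂μ

end NVLimit

end

noncomputable section

namespace NVLimit

/-! ### Counting pairs of particles in lattice cells -/

section Cells

variable {d : ℕ} {ι κ : Type*} [Fintype ι]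

/-! The finite volume forms are integrals of one fixed function against varying measures. Off the
diagonals, a null set, `F ∘ sym` is a smooth function of `(x₁, …, x_N)` whose gradient in the `i`-th
variable is `∇^Γ F({x₁, …, x_N}, xᵢ)`. So the finite volume form should be the integral of
`squareField F G` against the canonical Gibbs measure. This function is vaguely continuous, but weak
convergence does not apply at once because it is unbounded: it grows like the number of particles in
a bounded window. The main work is a second moment bound for that number, uniform in `N`, which
gives uniform integrability.

The moment bound (`exists_second_moment_bound`) is a superstability argument in the manner of
Ruelle. Cut space into cells with particle numbers `n_k`. If `n_0²` is at least a large `ψ`, there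
is a largest cube, of radius `q` and with `V_q = (2q + 1)^d` cells, in which `∑ n_k²` is at least `ψ
V_q`. As all larger cubes are sparse, the attraction exerted on the particles inside, by each other
and by the rest, is at most a constant times `∑ n_k²` over the cube. Short range repulsion beats any
such constant. Hence deleting the particles inside lowers the energy by at least this sum
(`exists_superstability`). The deleted configuration is compared with the partition function by
reinserting the particles anywhere in the volume, where each has weight of order `|Λ|`
(`exists_insertion_bound`, `lintegral_remove_particles`). Summing over the sets of deleted labels
costs `exp(D V_q)` against a gain `exp(-β ψ V_q / 2)`, which is summable in `q` for large `ψ`.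

To identify the closed form, note that the Gibbs density is bounded below on compact sets off the
diagonals. Therefore limits of core gradients are still weak gradients there and are unique
(`IsClosedGradient.ae_eq`), so the form is the expected integral (`finiteVolumeForm_eq_integral`).
The weak limit inherits the second moment bound by Fatou's lemma, and truncation gives convergence
of the integrals (`ConvergesWeakly.tendsto_integral_of_sq_bound`). -/

/-- The lattice cells at sup-distance at most `t` from `k`. -/
def cellBall {d : ℕ} (k : Fin d → ℤ) (t : ℕ) : Finset (Fin d → ℤ) :=
  Finset.Icc (fun a => k a - t) (fun a => k a + t)

theorem mem_cellBall {k l : Fin d → ℤ} {t : ℕ} : l ∈ cellBall k t ↔ ∀ a, |l a - k a| ≤ t := by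
  simp only [cellBall, Finset.mem_Icc, Pi.le_def, abs_le]
  constructor
  · rintro ⟨h₁, h₂⟩ a
    have := h₁ a
    have := h₂ a
    constructor <;> linarith
  · intro h
    exact ⟨fun a => by have := (h a).1; linarith, fun a => by have := (h a).2; linarith⟩

theorem mem_cellBall_comm {k l : Fin d → ℤ} {t : ℕ} : l ∈ cellBall k t ↔ k ∈ cellBall l t := by
  simp only [mem_cellBall, abs_sub_comm]

theorem mem_cellBall_self (k : Fin d → ℤ) (t : ℕ) : k ∈ cellBall k t := by
  simp [mem_cellBall]

theorem card_cellBall (k : Fin d → ℤ) (t : ℕ) : (cellBall k t).card = (2 * t + 1) ^ d := by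
  rw [cellBall, Pi.card_Icc]
  simp only [Int.card_Icc]
  rw [Finset.prod_congr rfl (g := fun _ => 2 * t + 1) (fun a _ => by omega)]
  simp

theorem mem_cellBall_add {k l m : Fin d → ℤ} {s t : ℕ} (h₁ : l ∈ cellBall k s)
    (h₂ : m ∈ cellBall l t) : m ∈ cellBall k (s + t) := by
  rw [mem_cellBall] at *
  intro a
  have := abs_add_le (m a - l a) (l a - k a)
  have h1 := h₁ a
  have h2 := h₂ a
  rw [sub_add_sub_cancel] at this
  push_cast
  linarith

open Classical in
/-- The number of particles in the cell `k`. -/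
def cellCount (r : ι → Fin d → ℤ) (k : Fin d → ℤ) : ℝ :=
  ∑ i, if r i = k then 1 else 0

/-- The sum of the squared particle numbers of the cells at distance at most `q` from the
origin. -/
def sqCount (r : ι → Fin d → ℤ) (q : ℕ) : ℝ := ∑ k ∈ cellBall 0 q, cellCount r k ^ 2

open Classical in
/-- The particles in the cells at distance at most `q` from the origin. -/
def innerParticles (r : ι → Fin d → ℤ) (q : ℕ) : Finset ι :=
  Finset.univ.filter fun i => r i ∈ cellBall 0 q

theorem cellCount_nonneg (r : ι → Fin d → ℤ) (k : Fin d → ℤ) : 0 ≤ cellCount r k :=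
  Finset.sum_nonneg fun i _ => by split_ifs <;> norm_num

theorem sqCount_nonneg (r : ι → Fin d → ℤ) (q : ℕ) : 0 ≤ sqCount r q :=
  Finset.sum_nonneg fun _ _ => sq_nonneg _

theorem sum_cell_eq (r : ι → Fin d → ℤ) (s : Finset (Fin d → ℤ)) (f : (Fin d → ℤ) → ℝ)
    [DecidableEq (Fin d → ℤ)] :
    ∑ i, (if r i ∈ s then f (r i) else 0) = ∑ k ∈ s, cellCount r k * f k := by
  classical
  simp only [cellCount, Finset.sum_mul]
  rw [Finset.sum_comm]
  refine Finset.sum_congr rfl fun i _ => ?_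
  simp only [ite_mul, one_mul, zero_mul]
  rw [Finset.sum_ite_eq]

theorem sum_innerParticles (r : ι → Fin d → ℤ) (q : ℕ) (f : (Fin d → ℤ) → ℝ) :
    ∑ i ∈ innerParticles r q, f (r i) = ∑ k ∈ cellBall 0 q, cellCount r k * f k := by
  classical
  rw [innerParticles, Finset.sum_filter, sum_cell_eq]

theorem card_innerParticles (r : ι → Fin d → ℤ) (q : ℕ) :
    ((innerParticles r q).card : ℝ) = ∑ k ∈ cellBall 0 q, cellCount r k := by
  have := sum_innerParticles r q fun _ => 1
  simpa using this

/-- Use `n_k n_l ≤ (n_k² + n_l²) / 2`. In the sum of `n_k²` every `k` is counted once per cell of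
its ball. In the sum of `n_l²` a fixed `l` is counted once per `k` in the intersection of two cubes,
which explains the minimum. -/
theorem sum_cell_pairs_le (r : ι → Fin d → ℤ) (q t : ℕ) :
    ∑ k ∈ cellBall 0 q, ∑ l ∈ cellBall k t, cellCount r k * cellCount r l ≤
      ((2 * t + 1) ^ d * sqCount r q +
        min ((2 * (q : ℝ) + 1) ^ d) ((2 * (t : ℝ) + 1) ^ d) * sqCount r (q + t)) / 2 := by
  classical
  have h₁ : ∑ k ∈ cellBall (0 : Fin d → ℤ) q, ∑ l ∈ cellBall k t, cellCount r k ^ 2 =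
      (2 * t + 1) ^ d * sqCount r q := by
    simp only [Finset.sum_const, card_cellBall, sqCount, Finset.mul_sum, nsmul_eq_mul]
    push_cast
    rfl
  have h₂ : ∑ k ∈ cellBall (0 : Fin d → ℤ) q, ∑ l ∈ cellBall k t, cellCount r l ^ 2 ≤
      min ((2 * (q : ℝ) + 1) ^ d) ((2 * (t : ℝ) + 1) ^ d) * sqCount r (q + t) := by
    rw [Finset.sum_comm' (t' := cellBall 0 (q + t)) (s' := fun l => cellBall 0 q ∩ cellBall l t)]
    · rw [sqCount, Finset.mul_sum]
      refine Finset.sum_le_sum fun l _ => ?_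
      rw [Finset.sum_const, nsmul_eq_mul]
      refine mul_le_mul_of_nonneg_right ?_ (sq_nonneg _)
      refine le_min ?_ ?_
      · have := Finset.card_le_card (Finset.inter_subset_left : cellBall (0 : Fin d → ℤ) q ∩
          cellBall l t ⊆ _)
        rw [card_cellBall] at this
        exact_mod_cast this
      · have := Finset.card_le_card (Finset.inter_subset_right : cellBall (0 : Fin d → ℤ) q ∩
          cellBall l t ⊆ _)
        rw [card_cellBall] at this
        exact_mod_cast this
    · intro k l
      rw [Finset.mem_inter, mem_cellBall_comm (k := l)]
      exact ⟨fun h => ⟨⟨h.1, h.2⟩, mem_cellBall_add h.1 h.2⟩, fun h => h.1⟩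
  calc _ ≤ ∑ k ∈ cellBall (0 : Fin d → ℤ) q, ∑ l ∈ cellBall k t,
        (cellCount r k ^ 2 / 2 + cellCount r l ^ 2 / 2) := by
        refine Finset.sum_le_sum fun k _ => Finset.sum_le_sum fun l _ => ?_
        nlinarith [sq_nonneg (cellCount r k - cellCount r l)]
    _ ≤ _ := by
        simp only [Finset.sum_add_distrib, ← Finset.sum_div]
        linarith

/-- If the cube of size `q` is the largest one whose squared particle numbers exceed `ψ` times its
volume, then the pairs at distance at most `t` are dominated by the squares inside. -/
theorem sum_cell_pairs_le_of_last (r : ι → Fin d → ℤ) {q : ℕ} {ψ : ℝ} (hψ : 0 ≤ ψ)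
    (hq : ψ * (2 * q + 1) ^ d ≤ sqCount r q)
    (hlast : ∀ j, q < j → sqCount r j ≤ ψ * (2 * j + 1) ^ d) (t : ℕ) :
    ∑ k ∈ cellBall 0 q, ∑ l ∈ cellBall k t, cellCount r k * cellCount r l ≤
      2 ^ d * (2 * t + 1) ^ d * sqCount r q := by
  refine (sum_cell_pairs_le r q t).trans ?_
  have hS := sqCount_nonneg r q
  have h2 : (1 : ℝ) ≤ 2 ^ d := one_le_pow₀ (by norm_num)
  have ht : (0 : ℝ) ≤ (2 * t + 1) ^ d := by positivity
  have hA : (2 * (t : ℝ) + 1) ^ d * sqCount r q ≤ 2 ^ d * (2 * t + 1) ^ d * sqCount r q := by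
    nlinarith [mul_nonneg ht hS]
  have hB : min ((2 * (q : ℝ) + 1) ^ d) ((2 * t + 1) ^ d) * sqCount r (q + t) ≤
      2 ^ d * (2 * t + 1) ^ d * sqCount r q := by
    -- Sparsity is known only for strictly larger cubes, so `t = 0` is treated separately.
    rcases Nat.eq_zero_or_pos t with rfl | htp
    · refine le_trans ?_ hA
      exact mul_le_mul_of_nonneg_right (min_le_right _ _) hS
    · have h := hlast (q + t) (by omega)
      -- As `2(q + t) + 1 ≤ 2(2 max(q, t) + 1)`, the volume of the cube of radius `q + t` is at most
      -- `2^d` times the larger of the two volumes; multiplied by the smaller one this is `2^d`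
      -- times their product.
      have hV : min ((2 * (q : ℝ) + 1) ^ d) ((2 * t + 1) ^ d) * (2 * ((q + t : ℕ) : ℝ) + 1) ^ d ≤
          2 ^ d * (2 * t + 1) ^ d * (2 * q + 1) ^ d := by
        rcases le_total q t with hqt | hqt
        · have hqt' : (q : ℝ) ≤ t := by exact_mod_cast hqt
          calc _ ≤ (2 * (q : ℝ) + 1) ^ d * (2 * (2 * t + 1)) ^ d := by
                refine mul_le_mul (min_le_left _ _) ?_ (by positivity) (by positivity)
                refine pow_le_pow_left₀ (by positivity) ?_ _
                push_cast
                linarith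
            _ = _ := by rw [mul_pow 2]; ring
        · have hqt' : (t : ℝ) ≤ q := by exact_mod_cast hqt
          calc _ ≤ (2 * (t : ℝ) + 1) ^ d * (2 * (2 * q + 1)) ^ d := by
                refine mul_le_mul (min_le_right _ _) ?_ (by positivity) (by positivity)
                refine pow_le_pow_left₀ (by positivity) ?_ _
                push_cast
                linarith
            _ = _ := by rw [mul_pow 2]; ring
      calc _ ≤ min ((2 * (q : ℝ) + 1) ^ d) ((2 * t + 1) ^ d) *
            (ψ * (2 * ((q + t : ℕ) : ℝ) + 1) ^ d) :=
            mul_le_mul_of_nonneg_left h (le_min (by positivity) (by positivity))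
        _ = ψ * (min ((2 * (q : ℝ) + 1) ^ d) ((2 * t + 1) ^ d) *
            (2 * ((q + t : ℕ) : ℝ) + 1) ^ d) := by ring
        _ ≤ ψ * (2 ^ d * (2 * t + 1) ^ d * (2 * q + 1) ^ d) := mul_le_mul_of_nonneg_left hV hψ
        _ = 2 ^ d * (2 * t + 1) ^ d * (ψ * (2 * q + 1) ^ d) := by ring
        _ ≤ _ := mul_le_mul_of_nonneg_left hq (by positivity)
  linarith

-- Cauchy–Schwarz: `n_k` is the sum over the classes `a : κ` of the numbers of particles of class
-- `a` in cell `k`, so many particles in a cell force many pairs in a common class. The pairs `i =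
-- j` are included and are subtracted later.
open Classical in
theorem sqCount_le_same_pairs (r : ι → Fin d → ℤ) [Fintype κ] (c : ι → κ) (q : ℕ) :
    sqCount r q ≤ Fintype.card κ * ∑ i ∈ innerParticles r q, ∑ j ∈ innerParticles r q,
      (if r i = r j ∧ c i = c j then (1 : ℝ) else 0) := by
  set m : (Fin d → ℤ) → κ → ℝ := fun k a => ∑ i, if r i = k ∧ c i = a then 1 else 0 with hm
  have h₁ : ∀ k, cellCount r k = ∑ a, m k a := by
    intro k
    simp only [cellCount, hm]
    rw [Finset.sum_comm]
    refine Finset.sum_congr rfl fun i _ => ?_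
    by_cases h : r i = k <;> simp [h]
  have h₂ : ∑ i ∈ innerParticles r q, ∑ j ∈ innerParticles r q,
      (if r i = r j ∧ c i = c j then (1 : ℝ) else 0) = ∑ k ∈ cellBall 0 q, ∑ a, m k a ^ 2 := by
    calc _ = ∑ i ∈ innerParticles r q, m (r i) (c i) := by
          refine Finset.sum_congr rfl fun i hi => ?_
          simp only [hm]
          rw [innerParticles, Finset.sum_filter]
          refine Finset.sum_congr rfl fun j _ => ?_
          have hi' : r i ∈ cellBall 0 q := by simpa [innerParticles] using hi
          by_cases h : r j = r i
          · simp [h, hi', eq_comm]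
          · have h' : ¬ r i = r j := fun e => h e.symm
            simp [h, h']
      _ = ∑ i ∈ innerParticles r q, ∑ k ∈ cellBall 0 q, ∑ a,
            if r i = k ∧ c i = a then m k a else 0 := by
          refine Finset.sum_congr rfl fun i hi => ?_
          have hi' : r i ∈ cellBall 0 q := by simpa [innerParticles] using hi
          rw [Finset.sum_eq_single_of_mem (r i) hi', Finset.sum_eq_single_of_mem (c i)
            (Finset.mem_univ _)]
          · simp
          · intro a _ ha
            simp [ha.symm]
          · intro k _ hk
            simp [hk.symm]
      _ = _ := by
          rw [Finset.sum_comm]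
          refine Finset.sum_congr rfl fun k hk => ?_
          rw [Finset.sum_comm]
          refine Finset.sum_congr rfl fun a _ => ?_
          rw [innerParticles, Finset.sum_filter, pow_two]
          nth_rewrite 2 [hm]
          simp only [Finset.sum_mul]
          refine Finset.sum_congr rfl fun i _ => ?_
          by_cases h : r i = k
          · simp [h, hk]
          · simp [h]
  rw [h₂, sqCount, Finset.mul_sum]
  refine Finset.sum_le_sum fun k _ => ?_
  rw [h₁ k]
  exact sq_sum_le_card_mul_sum_sq

open Classical in
/-- Superstability: lower bound for the energy of the particles in the last dense cube, including
their interaction with all other particles. -/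
theorem inner_energy_lower_bound [DecidableEq ι] [Fintype κ] [Nonempty κ] (r : ι → Fin d → ℤ) (c : ι → κ)
    (w : ι → ι → ℝ) {K ψ L : ℝ} (hK : 0 ≤ K) (hψ : 0 ≤ ψ) (b : ℕ → ℝ) (hb : ∀ t, 0 ≤ b t) (T : ℕ)
    (hdiag : ∀ i, w i i = 0)
    (hsame : ∀ i j, i ≠ j → r i = r j → c i = c j → K ≤ w i j)
    (hlow : ∀ i j, i ≠ j →
      -∑ t ∈ Finset.range T, (if r j ∈ cellBall (r i) t then b t else 0) ≤ w i j)
    (hL : ∑ t ∈ Finset.range T, b t * (2 * t + 1) ^ d ≤ L) {q : ℕ}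
    (hq : ψ * (2 * q + 1) ^ d ≤ sqCount r q)
    (hlast : ∀ j, q < j → sqCount r j ≤ ψ * (2 * j + 1) ^ d) :
    K / 2 * (sqCount r q / Fintype.card κ - (innerParticles r q).card) - 2 ^ d * L * sqCount r q ≤
      (∑ i ∈ innerParticles r q, ∑ j ∈ innerParticles r q, w i j) / 2 +
        ∑ i ∈ innerParticles r q, ∑ j ∈ (innerParticles r q)ᶜ, w i j := by
  set I := innerParticles r q with hI
  set J : ι → ι → ℝ := fun i j =>
    ∑ t ∈ Finset.range T, (if r j ∈ cellBall (r i) t then b t else 0) with hJ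
  have hJ0 : ∀ i j, 0 ≤ J i j := fun i j =>
    Finset.sum_nonneg fun t _ => by split_ifs; exacts [hb t, le_rfl]
  have hJsum : ∑ i ∈ I, ∑ j, J i j ≤ 2 ^ d * L * sqCount r q := by
    have h₁ : ∑ i ∈ I, ∑ j, J i j = ∑ t ∈ Finset.range T, b t *
        ∑ k ∈ cellBall 0 q, ∑ l ∈ cellBall k t, cellCount r k * cellCount r l := by
      calc _ = ∑ i ∈ I, ∑ t ∈ Finset.range T, b t * ∑ l ∈ cellBall (r i) t, cellCount r l := by
            refine Finset.sum_congr rfl fun i _ => ?_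
            simp only [hJ]
            rw [Finset.sum_comm]
            refine Finset.sum_congr rfl fun t _ => ?_
            rw [sum_cell_eq r (cellBall (r i) t) fun _ => b t, ← Finset.sum_mul, mul_comm]
        _ = _ := by
            rw [Finset.sum_comm]
            refine Finset.sum_congr rfl fun t _ => ?_
            rw [← Finset.mul_sum, hI,
              sum_innerParticles r q fun k => ∑ l ∈ cellBall k t, cellCount r l]
            simp only [Finset.mul_sum]
    rw [h₁]
    calc _ ≤ ∑ t ∈ Finset.range T, b t * (2 ^ d * (2 * t + 1) ^ d * sqCount r q) :=
          Finset.sum_le_sum fun t _ => mul_le_mul_of_nonneg_left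
            (sum_cell_pairs_le_of_last r hψ hq hlast t) (hb t)
      _ = (2 ^ d * sqCount r q) * ∑ t ∈ Finset.range T, b t * (2 * t + 1) ^ d := by
          rw [Finset.mul_sum]
          exact Finset.sum_congr rfl fun t _ => by ring
      _ ≤ (2 ^ d * sqCount r q) * L :=
          mul_le_mul_of_nonneg_left hL (mul_nonneg (by positivity) (sqCount_nonneg r q))
      _ = _ := by ring
  -- The term `K / 2` at `i = j` removes the self-pairs counted by the indicator. Although the
  -- energy carries a factor `1/2`, `J` is subtracted in full, so that the inner and outer errors
  -- add up to the single sum bounded in `hJsum`.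
  have hin : ∑ i ∈ I, ∑ j ∈ I, (K / 2 * (if r i = r j ∧ c i = c j then (1 : ℝ) else 0) -
      (if i = j then K / 2 else 0) - J i j) ≤ (∑ i ∈ I, ∑ j ∈ I, w i j) / 2 := by
    simp only [Finset.sum_div]
    refine Finset.sum_le_sum fun i _ => Finset.sum_le_sum fun j _ => ?_
    have hJij := hJ0 i j
    by_cases hij : i = j
    · subst hij
      simp only [and_self, if_true, hdiag]
      linarith
    · simp only [hij, if_false]
      by_cases hs : r i = r j ∧ c i = c j
      · rw [if_pos hs]
        have := hsame i j hij hs.1 hs.2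
        linarith
      · rw [if_neg hs]
        have := hlow i j hij
        change -J i j ≤ _ at this
        linarith
  have hout : -∑ i ∈ I, ∑ j ∈ Iᶜ, J i j ≤ ∑ i ∈ I, ∑ j ∈ Iᶜ, w i j := by
    rw [← Finset.sum_neg_distrib]
    refine Finset.sum_le_sum fun i hi => ?_
    rw [← Finset.sum_neg_distrib]
    refine Finset.sum_le_sum fun j hj => ?_
    refine hlow i j ?_
    rintro rfl
    exact (Finset.mem_compl.1 hj) hi
  have hsplit : ∑ i ∈ I, ∑ j, J i j = ∑ i ∈ I, ∑ j ∈ I, J i j + ∑ i ∈ I, ∑ j ∈ Iᶜ, J i j := by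
    rw [← Finset.sum_add_distrib]
    exact Finset.sum_congr rfl fun i _ => (Finset.sum_add_sum_compl I _).symm
  have hdg : ∑ i ∈ I, ∑ j ∈ I, (if i = j then K / 2 else 0) = K / 2 * I.card := by
    rw [Finset.sum_congr rfl (g := fun _ => K / 2)]
    · simp [mul_comm]
    · intro i hi
      simp [hi]
  simp only [Finset.sum_sub_distrib, ← Finset.mul_sum] at hin
  rw [hdg] at hin
  have hsq := sqCount_le_same_pairs r c q
  rw [← hI] at hsq
  have hcard : (0 : ℝ) < Fintype.card κ := by exact_mod_cast Fintype.card_pos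
  have hsq' : sqCount r q / Fintype.card κ ≤ ∑ i ∈ I, ∑ j ∈ I,
      (if r i = r j ∧ c i = c j then (1 : ℝ) else 0) := by
    rw [div_le_iff₀ hcard, mul_comm]
    exact hsq
  have := mul_le_mul_of_nonneg_left hsq' (div_nonneg hK zero_le_two)
  linarith

end Cells

/-! ### Cells and subcells of side `s` -/

section Lattice

variable {d : ℕ}

/-- The index of the cell of side `s` containing `x`; the cell `0` is centred at the origin. -/
def cellIndex (s : ℝ) (x : Space d) : Fin d → ℤ := fun a => ⌊x a / s + 1 / 2⌋

/-- The position of `x` in the subdivision of its cell into `(m + 1)^d` subcells. -/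
def subcellIndex (s : ℝ) (m : ℕ) (x : Space d) : Fin d → Fin (m + 1) := fun a =>
  ⟨⌊((m : ℝ) + 1) * Int.fract (x a / s + 1 / 2)⌋₊, by
    rw [Nat.floor_lt (mul_nonneg (by positivity) (Int.fract_nonneg _))]
    have := Int.fract_lt_one (x a / s + 1 / 2)
    push_cast
    have hm : (0 : ℝ) < m + 1 := by positivity
    nlinarith⟩

/-- Two points of one subcell differ by at most the side `s / (m + 1)` in every coordinate; the
factor `√d` passes to the Euclidean norm. -/
theorem norm_sub_le_of_subcell_eq {s : ℝ} (hs : 0 < s) (m : ℕ) {x y : Space d}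
    (h₁ : cellIndex s x = cellIndex s y) (h₂ : subcellIndex s m x = subcellIndex s m y) :
    ‖x - y‖ ≤ √d * (s / (m + 1)) := by
  have hm : (0 : ℝ) < m + 1 := by positivity
  have key : ∀ a, |(x - y) a| ≤ s / (m + 1) := by
    intro a
    have e₁ : ⌊x a / s + 1 / 2⌋ = ⌊y a / s + 1 / 2⌋ := congrFun h₁ a
    have e₂ : ⌊((m : ℝ) + 1) * Int.fract (x a / s + 1 / 2)⌋₊ =
        ⌊((m : ℝ) + 1) * Int.fract (y a / s + 1 / 2)⌋₊ := congrArg Fin.val (congrFun h₂ a)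
    set u := x a / s + 1 / 2 with hu
    set w := y a / s + 1 / 2 with hw
    have hfu := Int.floor_add_fract u
    have hfw := Int.floor_add_fract w
    have a₁ := Nat.floor_le (mul_nonneg hm.le (Int.fract_nonneg u))
    have a₂ := Nat.lt_floor_add_one (((m : ℝ) + 1) * Int.fract u)
    have a₃ := Nat.floor_le (mul_nonneg hm.le (Int.fract_nonneg w))
    have a₄ := Nat.lt_floor_add_one (((m : ℝ) + 1) * Int.fract w)
    rw [e₂] at a₁ a₂
    rw [e₁] at hfu
    have hxy : (x - y) a = s * (Int.fract u - Int.fract w) := by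
      have : Int.fract u - Int.fract w = u - w := by linarith
      rw [this, hu, hw, PiLp.sub_apply]
      field_simp
      ring
    have hd : |Int.fract u - Int.fract w| ≤ 1 / (m + 1) := by
      rw [le_div_iff₀ hm]
      nth_rewrite 1 [← abs_of_pos hm]
      rw [← abs_mul, abs_le]
      constructor <;> nlinarith
    rw [hxy, abs_mul, abs_of_pos hs, div_eq_mul_one_div]
    exact mul_le_mul_of_nonneg_left hd hs.le
  have h0 : 0 ≤ s / (m + 1) := by positivity
  rw [EuclideanSpace.norm_eq]
  calc √(∑ a, ‖(x - y) a‖ ^ 2) ≤ √(∑ _a : Fin d, (s / (m + 1)) ^ 2) := by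
        refine Real.sqrt_le_sqrt (Finset.sum_le_sum fun a _ => ?_)
        exact pow_le_pow_left₀ (norm_nonneg _) (key a) 2
    _ = _ := by
        rw [Finset.sum_const, Finset.card_univ, Fintype.card_fin, nsmul_eq_mul,
          Real.sqrt_mul (Nat.cast_nonneg d), Real.sqrt_sq h0]

/-- Some coordinate has integer parts differing by at least `t + 1`, hence the scaled coordinates
themselves differ by at least `t`. -/
theorem le_norm_sub_of_notMem_cellBall {s : ℝ} (hs : 0 < s) {x y : Space d} {t : ℕ}
    (h : cellIndex s y ∉ cellBall (cellIndex s x) t) : t * s ≤ ‖x - y‖ := by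
  rw [mem_cellBall] at h
  push Not at h
  obtain ⟨a, ha⟩ := h
  have hfl : (t : ℝ) + 1 ≤ |((⌊y a / s + 1 / 2⌋ - ⌊x a / s + 1 / 2⌋ : ℤ) : ℝ)| := by
    have : (t : ℤ) + 1 ≤ |⌊y a / s + 1 / 2⌋ - ⌊x a / s + 1 / 2⌋| := ha
    exact_mod_cast this
  have e₁ := Int.floor_le (y a / s + 1 / 2)
  have e₂ := Int.lt_floor_add_one (y a / s + 1 / 2)
  have e₃ := Int.floor_le (x a / s + 1 / 2)
  have e₄ := Int.lt_floor_add_one (x a / s + 1 / 2)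
  have h₁ : (t : ℝ) ≤ |(x - y) a| / s := by
    nth_rewrite 1 [← abs_of_pos hs]
    have e : (x - y) a / s = x a / s - y a / s := sub_div (x a) (y a) s
    rw [← abs_div, e]
    push_cast at hfl
    rcases le_abs.1 hfl with h' | h'
    · rw [abs_sub_comm]
      exact le_trans (by linarith) (le_abs_self _)
    · exact le_trans (by linarith) (le_abs_self _)
  rw [le_div_iff₀ hs] at h₁
  exact h₁.trans (PiLp.norm_apply_le (x - y) a)

theorem exists_mem_cellBall (k l : Fin d → ℤ) : ∃ t, l ∈ cellBall k t := by
  refine ⟨∑ a, (l a - k a).natAbs, mem_cellBall.2 fun a => ?_⟩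
  rw [Int.abs_eq_natAbs]
  exact_mod_cast Finset.single_le_sum (f := fun a => (l a - k a).natAbs)
    (fun _ _ => Nat.zero_le _) (Finset.mem_univ a)

open Classical in
/-- The attractive part of a tempered potential bounded from below is dominated by a summable
superposition of indicators of lattice balls. -/
theorem exists_lower_interaction_bound (hd : 1 ≤ d) {v : Space d → ℝ} {B A R l s : ℝ}
    (hB : ∀ x, -B ≤ v x) (hB0 : 0 ≤ B) (hl : (d : ℝ) < l)
    (hT : ∀ x : Space d, R ≤ ‖x‖ → |v x| ≤ A * ‖x‖ ^ (-l)) (hs : 0 < s) :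
    ∃ (b : ℕ → ℝ) (L : ℝ), (∀ t, 0 ≤ b t) ∧ 0 ≤ L ∧
      (∀ T, ∑ t ∈ Finset.range T, b t * (2 * t + 1) ^ d ≤ L) ∧
      ∀ x y : Space d, ∀ᶠ T in atTop, -∑ t ∈ Finset.range T,
        (if cellIndex s y ∈ cellBall (cellIndex s x) t then b t else 0) ≤ v (x - y) := by
  have hd0 : (0 : ℝ) < d := by exact_mod_cast hd
  have hl0 : 0 < l := hd0.trans hl
  obtain ⟨k₀, hk₀⟩ := exists_nat_gt (R / s)
  -- The first summand handles cell distances up to `k₀ + 2` by the global bound `-B`. The second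
  -- handles larger ones by temperedness: there the points are at distance at least `(k - 1)s`,
  -- which exceeds both `R` and `s(k + 1)/3`.
  set a : ℝ := B * ((k₀ : ℝ) + 3) ^ l + |A| * s ^ (-l) * 3 ^ l with ha
  have ha0 : 0 ≤ a := by positivity
  -- the pointwise bound in terms of the cell distance
  have hdist : ∀ x y : Space d, ∀ k : ℕ,
      (∀ t < k, cellIndex s y ∉ cellBall (cellIndex s x) t) →
      -(a * ((k : ℝ) + 1) ^ (-l)) ≤ v (x - y) := by
    intro x y k hk
    have hk1 : (0 : ℝ) < (k : ℝ) + 1 := by positivity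
    rcases le_or_gt k (k₀ + 2) with hle | hgt
    · refine le_trans (neg_le_neg ?_) (hB _)
      have hle' : (k : ℝ) + 1 ≤ k₀ + 3 := by
        have : (k : ℝ) ≤ k₀ + 2 := by exact_mod_cast hle
        linarith
      have h1 : B * ((k₀ : ℝ) + 3) ^ l ≤ a := by
        rw [ha]
        have : 0 ≤ |A| * s ^ (-l) * 3 ^ l := by positivity
        linarith
      have h2 : ((k : ℝ) + 1) ^ l ≤ ((k₀ : ℝ) + 3) ^ l :=
        Real.rpow_le_rpow hk1.le hle' hl0.le
      rw [Real.rpow_neg hk1.le, ← div_eq_mul_inv, le_div_iff₀ (Real.rpow_pos_of_pos hk1 _)]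
      exact (mul_le_mul_of_nonneg_left h2 hB0).trans h1
    · have hk2 : (k₀ : ℝ) + 3 ≤ k := by exact_mod_cast hgt
      have hk0 : (0 : ℝ) ≤ k₀ := Nat.cast_nonneg _
      have hn := le_norm_sub_of_notMem_cellBall hs (hk (k - 1) (by omega))
      rw [Nat.cast_sub (by omega)] at hn
      push_cast at hn
      have hthird : s * (((k : ℝ) + 1) / 3) ≤ ‖x - y‖ := by
        refine le_trans ?_ hn
        nlinarith
      have hR : R ≤ ‖x - y‖ := by
        refine le_trans ?_ hn
        rw [div_lt_iff₀ hs] at hk₀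
        nlinarith
      have h1 := hT _ hR
      have hpos : 0 < s * (((k : ℝ) + 1) / 3) := by positivity
      have h2 : ‖x - y‖ ^ (-l) ≤ (s * (((k : ℝ) + 1) / 3)) ^ (-l) :=
        Real.rpow_le_rpow_of_nonpos hpos hthird (by linarith)
      have h3 : (s * (((k : ℝ) + 1) / 3)) ^ (-l) = s ^ (-l) * 3 ^ l * ((k : ℝ) + 1) ^ (-l) := by
        rw [Real.mul_rpow hs.le (by positivity), Real.div_rpow hk1.le (by norm_num),
          Real.rpow_neg (by norm_num : (0 : ℝ) ≤ 3), div_inv_eq_mul]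
        ring
      have h4 : A * ‖x - y‖ ^ (-l) ≤ a * ((k : ℝ) + 1) ^ (-l) := by
        calc _ ≤ |A| * ‖x - y‖ ^ (-l) :=
              mul_le_mul_of_nonneg_right (le_abs_self A) (by positivity)
          _ ≤ |A| * (s ^ (-l) * 3 ^ l * ((k : ℝ) + 1) ^ (-l)) := by
              rw [← h3]
              exact mul_le_mul_of_nonneg_left h2 (abs_nonneg A)
          _ = |A| * s ^ (-l) * 3 ^ l * ((k : ℝ) + 1) ^ (-l) := by ring
          _ ≤ _ := by
              refine mul_le_mul_of_nonneg_right ?_ (by positivity)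
              rw [ha]
              have : 0 ≤ B * ((k₀ : ℝ) + 3) ^ l := by positivity
              linarith
      exact neg_le_of_abs_le (h1.trans h4)
  -- The decay `(k + 1)^(-l)` is written as a superposition of indicators of balls: a pair at cell
  -- distance `k` lies in all balls with `k ≤ t ≤ 2k`, and these `k + 1` terms, each at least `a (k
  -- + 1)^(-(l + 1))`, already add up to `a (k + 1)^(-l)`. Against the volumes of the balls, `b t`
  -- is summable since `l > d`.
  set b : ℕ → ℝ := fun t => a * 2 ^ (l + 1) * ((t : ℝ) + 1) ^ (-(l + 1)) with hb
  have hb0 : ∀ t, 0 ≤ b t := fun t => by simp only [hb]; positivity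
  have hsum : Summable fun t : ℕ => b t * (2 * t + 1) ^ d := by
    have h1 : Summable fun t : ℕ => a * 2 ^ (l + 1) * 2 ^ d * (((t + 1 : ℕ) : ℝ) ^ ((d : ℝ) - l - 1)) :=
      ((summable_nat_add_iff 1).2
        (Real.summable_nat_rpow.2 (by linarith : (d : ℝ) - l - 1 < -1))).mul_left _
    refine Summable.of_nonneg_of_le (fun t => mul_nonneg (hb0 t) (by positivity)) (fun t => ?_) h1
    have ht : (0 : ℝ) < (t : ℝ) + 1 := by positivity
    have e : (((t + 1 : ℕ) : ℝ) ^ ((d : ℝ) - l - 1)) =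
        ((t : ℝ) + 1) ^ (-(l + 1)) * ((t : ℝ) + 1) ^ d := by
      rw [← Real.rpow_natCast ((t : ℝ) + 1) d, ← Real.rpow_add ht]
      push_cast
      congr 1
      ring
    have h2 : (2 * (t : ℝ) + 1) ^ d ≤ 2 ^ d * ((t : ℝ) + 1) ^ d := by
      rw [← mul_pow]
      exact pow_le_pow_left₀ (by positivity) (by linarith) d
    rw [e]
    calc _ ≤ b t * (2 ^ d * ((t : ℝ) + 1) ^ d) := mul_le_mul_of_nonneg_left h2 (hb0 t)
      _ = _ := by simp only [hb]; ring
  refine ⟨b, ∑' t : ℕ, b t * (2 * t + 1) ^ d, hb0,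
    tsum_nonneg fun t => mul_nonneg (hb0 t) (by positivity), fun T =>
    hsum.sum_le_tsum _ fun t _ => mul_nonneg (hb0 t) (by positivity), fun x y => ?_⟩
  have hex := exists_mem_cellBall (cellIndex s x) (cellIndex s y)
  set k := Nat.find hex with hkdef
  have hmem := Nat.find_spec hex
  filter_upwards [eventually_ge_atTop (2 * k + 1)] with T hTk
  refine le_trans (neg_le_neg ?_) (hdist x y k fun t ht => Nat.find_min hex ht)
  have hk1 : (0 : ℝ) < (k : ℝ) + 1 := by positivity
  calc a * ((k : ℝ) + 1) ^ (-l) = ((k : ℝ) + 1) * (a * 2 ^ (l + 1) * (2 * ((k : ℝ) + 1)) ^ (-(l + 1))) := by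
        rw [Real.mul_rpow (by norm_num) hk1.le, Real.rpow_neg (by norm_num : (0 : ℝ) ≤ 2),
          show -(l + 1) = -l + -1 by ring, Real.rpow_add hk1, Real.rpow_neg_one]
        have : (2 : ℝ) ^ (l + 1) ≠ 0 := (Real.rpow_pos_of_pos (by norm_num) _).ne'
        field_simp
    _ = ∑ t ∈ Finset.Icc k (2 * k), a * 2 ^ (l + 1) * (2 * ((k : ℝ) + 1)) ^ (-(l + 1)) := by
        rw [Finset.sum_const, Nat.card_Icc, nsmul_eq_mul]
        congr 1
        rw [show 2 * k + 1 - k = k + 1 by omega]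
        push_cast
        ring
    _ ≤ ∑ t ∈ Finset.Icc k (2 * k),
          (if cellIndex s y ∈ cellBall (cellIndex s x) t then b t else 0) := by
        refine Finset.sum_le_sum fun t ht => ?_
        rw [Finset.mem_Icc] at ht
        have hmt : cellIndex s y ∈ cellBall (cellIndex s x) t := by
          rw [mem_cellBall] at hmem ⊢
          intro c
          have h1 : (k : ℤ) ≤ t := by exact_mod_cast ht.1
          exact (hmem c).trans h1
        rw [if_pos hmt]
        refine mul_le_mul_of_nonneg_left ?_ (by positivity)
        refine Real.rpow_le_rpow_of_nonpos (by positivity) ?_ (by linarith)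
        have h1 : (t : ℝ) ≤ 2 * k := by exact_mod_cast ht.2
        linarith
    _ ≤ _ := by
        refine Finset.sum_le_sum_of_subset_of_nonneg (fun t ht => ?_) fun t _ _ => ?_
        · rw [Finset.mem_Icc] at ht
          exact Finset.mem_range.2 (by omega)
        · split_ifs
          exacts [hb0 t, le_rfl]

/-- On small subcells the potential exceeds any multiple of the number of subcells. -/
theorem exists_subdivision {φ : Space d → EReal} (hd : 1 ≤ d) (hφ : IsPairPotential φ)
    (hRP : Repulsive φ) {s : ℝ} (hs : 0 < s) (c : ℝ) :
    ∃ (m : ℕ) (K : ℝ), 0 ≤ K ∧ c * ((m : ℝ) + 1) ^ d ≤ K ∧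
      ∀ x : Space d, x ≠ 0 → ‖x‖ ≤ √d * (s / (m + 1)) → K ≤ (φ x).toReal := by
  obtain ⟨Φ, hΦ⟩ := hRP
  obtain ⟨R, hR, hlow, -⟩ := hΦ.bounds
  have hd0 : (0 : ℝ) < √d := Real.sqrt_pos.2 (by exact_mod_cast hd)
  have hlim0 : Tendsto (fun m : ℕ => √d * (s / ((m : ℝ) + 1))) atTop (𝓝 0) := by
    have h := (tendsto_one_div_add_atTop_nhds_zero_nat (𝕜 := ℝ)).const_mul (√d * s)
    rw [mul_zero] at h
    refine h.congr fun m => ?_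
    ring
  have hlim : Tendsto (fun m : ℕ => √d * (s / ((m : ℝ) + 1))) atTop (𝓝[>] 0) :=
    tendsto_nhdsWithin_iff.2 ⟨hlim0, Eventually.of_forall fun m => by
      exact Set.mem_Ioi.2 (by positivity)⟩
  -- With `δ` the diameter bound of a subcell, `√d s = δ (m + 1)`, so `Φ(δ) δ^d ≥ c (√d s)^d` means
  -- exactly `Φ(δ) ≥ c (m + 1)^d`.
  have h₁ := (hΦ.tendsto.comp hlim).eventually_ge_atTop (c * (√d * s) ^ d)
  have h₂ := hlim0.eventually_le_const hR
  obtain ⟨m, hm₁, hm₂⟩ := (h₁.and h₂).exists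
  set δ := √d * (s / ((m : ℝ) + 1)) with hδ
  have hδ0 : 0 < δ := by positivity
  refine ⟨m, Φ δ, hΦ.nonneg δ hδ0, ?_, fun x hx hxδ => ?_⟩
  · have e : √d * s = δ * ((m : ℝ) + 1) := by
      rw [hδ]
      field_simp
    change c * (√d * s) ^ d ≤ Φ δ * δ ^ d at hm₁
    rw [e, mul_pow] at hm₁
    have hδd : 0 < δ ^ d := by positivity
    nlinarith
  · have hx0 : 0 < ‖x‖ := norm_pos_iff.2 hx
    have h := hlow x hx (hxδ.trans hm₂)
    have h' : Φ ‖x‖ ≤ (φ x).toReal := by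
      rw [← EReal.coe_toReal (hφ.ne_top x hx) (hφ.ne_bot x)] at h
      exact_mod_cast h
    exact (hΦ.antitone hx0 hδ0 hxδ).trans h'

end Lattice

/-! ### Superstability -/

section Superstability

variable {d : ℕ} {ι : Type*} [DecidableEq ι]

/-- The energy of the particles with label in `T`. -/
def pairEnergy (v : Space d → ℝ) (T : Finset ι) (x : ι → Space d) : ℝ :=
  (∑ i ∈ T, ∑ j ∈ T, if i = j then 0 else v (x i - x j)) / 2

theorem pairEnergy_univ [Fintype ι] {v : Space d → ℝ} (hv : ∀ x, v (-x) = v x) (I : Finset ι)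
    (x : ι → Space d) :
    pairEnergy v Finset.univ x = pairEnergy v Iᶜ x + pairEnergy v I x +
      ∑ i ∈ I, ∑ j ∈ Iᶜ, if i = j then 0 else v (x i - x j) := by
  set w : ι → ι → ℝ := fun i j => if i = j then 0 else v (x i - x j) with hw
  have hsymm : ∀ i j, w i j = w j i := by
    intro i j
    simp only [hw, eq_comm (a := i)]
    rw [← neg_sub, hv]
  change (∑ i, ∑ j, w i j) / 2 = (∑ i ∈ Iᶜ, ∑ j ∈ Iᶜ, w i j) / 2 +
    (∑ i ∈ I, ∑ j ∈ I, w i j) / 2 + ∑ i ∈ I, ∑ j ∈ Iᶜ, w i j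
  have h₁ : ∑ i, ∑ j, w i j = ∑ i, (∑ j ∈ I, w i j + ∑ j ∈ Iᶜ, w i j) :=
    Finset.sum_congr rfl fun i _ => (Finset.sum_add_sum_compl I _).symm
  have h₂ : ∑ i ∈ Iᶜ, ∑ j ∈ I, w i j = ∑ i ∈ I, ∑ j ∈ Iᶜ, w i j := by
    rw [Finset.sum_comm]
    exact Finset.sum_congr rfl fun i _ => Finset.sum_congr rfl fun j _ => hsymm j i
  rw [h₁, ← Finset.sum_add_sum_compl I, Finset.sum_add_distrib, Finset.sum_add_distrib, h₂]
  ring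

theorem pairEnergy_insert {v : Space d → ℝ} (hv : ∀ x, v (-x) = v x) {a : ι} {T : Finset ι}
    (ha : a ∉ T) (x : ι → Space d) :
    pairEnergy v (insert a T) x = pairEnergy v T x + ∑ j ∈ T, v (x a - x j) := by
  have h₁ : ∀ j ∈ T, a ≠ j := fun j hj h => ha (h ▸ hj)
  have h₂ : ∑ j ∈ T, (if a = j then 0 else v (x a - x j)) = ∑ j ∈ T, v (x a - x j) :=
    Finset.sum_congr rfl fun j hj => if_neg (h₁ j hj)
  have h₃ : ∑ i ∈ T, (if i = a then 0 else v (x i - x a)) = ∑ j ∈ T, v (x a - x j) :=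
    Finset.sum_congr rfl fun j hj => by rw [if_neg (h₁ j hj).symm, ← neg_sub, hv]
  simp only [pairEnergy, Finset.sum_insert ha, if_true, Finset.sum_add_distrib]
  rw [h₂, h₃]
  ring

theorem pairEnergy_congr (v : Space d → ℝ) {T : Finset ι} {x y : ι → Space d}
    (h : ∀ i ∈ T, x i = y i) : pairEnergy v T x = pairEnergy v T y := by
  unfold pairEnergy
  congr 1
  refine Finset.sum_congr rfl fun i hi => Finset.sum_congr rfl fun j hj => ?_
  rw [h i hi, h j hj]

theorem measurable_pairEnergy {v : Space d → ℝ} (hv : Measurable v) (T : Finset ι) :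
    Measurable (pairEnergy v T) := by
  unfold pairEnergy
  refine Measurable.div_const (Finset.measurable_sum _ fun i _ =>
    Finset.measurable_sum _ fun j _ => ?_) _
  split_ifs
  · exact measurable_const
  · exact hv.comp ((measurable_pi_apply i).sub (measurable_pi_apply j))

/-- Evenness of `φ` turns the sum over `i < j` into half the sum over ordered pairs, a form that
makes sense for any set of labels and so allows particles to be deleted. -/
theorem energy_eq_pairEnergy {N : ℕ} {φ : Space d → EReal} (hφ : ∀ x, φ (-x) = φ x)
    (x : Fin N → Space d) :
    energy φ x = pairEnergy (fun y => (φ y).toReal) Finset.univ x := by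
  have h := Finset.sum_sum_Ioi_add_eq_sum_sum_off_diag fun i j : Fin N => (φ (x j - x i)).toReal
  have h₁ : ∀ i j : Fin N, (φ (x j - x i)).toReal = (φ (x i - x j)).toReal := fun i j => by
    rw [← neg_sub, hφ]
  have h₂ : ∑ i, ∑ j ∈ {i}ᶜ, (φ (x i - x j)).toReal =
      ∑ i, ∑ j, if i = j then 0 else (φ (x i - x j)).toReal := by
    refine Finset.sum_congr rfl fun i _ => ?_
    rw [← Finset.sum_add_sum_compl {i}, Finset.sum_singleton, if_pos rfl, zero_add]
    refine Finset.sum_congr rfl fun j hj => ?_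
    rw [if_neg]
    rintro rfl
    simp at hj
  simp only [h₁, ← two_mul, ← Finset.mul_sum] at h
  rw [pairEnergy, ← h₂, energy, ← h]
  ring

/-- In the last cube that is denser than `ψ`, the particles have energy at least the sum of the
squared cell numbers, including the interaction with the rest of the configuration. -/
theorem exists_superstability {φ : Space d → EReal} (hd : 1 ≤ d) (hφ : IsPairPotential φ)
    (hRP : Repulsive φ) (hT : Tempered φ) (hBB : BoundedFromBelow φ) {s : ℝ} (hs : 0 < s) :
    ∃ ψ₀ : ℝ, 0 < ψ₀ ∧ ∀ ψ, ψ₀ ≤ ψ → ∀ (N : ℕ) (x : Fin N → Space d), Function.Injective x →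
      ∀ q : ℕ, ψ * (2 * q + 1) ^ d ≤ sqCount (cellIndex s ∘ x) q →
      (∀ j, q < j → sqCount (cellIndex s ∘ x) j ≤ ψ * (2 * j + 1) ^ d) →
      pairEnergy (fun y => (φ y).toReal) (innerParticles (cellIndex s ∘ x) q)ᶜ x +
        sqCount (cellIndex s ∘ x) q ≤ pairEnergy (fun y => (φ y).toReal) Finset.univ x := by
  obtain ⟨A, R, l, hR, hl, hA⟩ := hT
  obtain ⟨B, hB0, hB⟩ := hBB
  have hB' : ∀ x, -B ≤ (φ x).toReal := by
    intro x
    rcases eq_or_ne (φ x) ⊤ with h | h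
    · rw [h, EReal.toReal_top]
      linarith
    · have := hB x
      rw [← EReal.coe_toReal h (hφ.ne_bot x)] at this
      exact_mod_cast this
  obtain ⟨b, L, hb, hL0, hL, hlow⟩ := exists_lower_interaction_bound hd hB' hB0 hl hA hs
  -- `L` depends on the cell side but not on the subdivision, so `m` may be chosen after it. The
  -- factor 8 compensates the `K / 2` and the `S / (4M)` in `hgain`; the `+ 1` is the surplus left
  -- after paying for the attraction.
  obtain ⟨m, K, hK0, hK, hKφ⟩ := exists_subdivision hd hφ hRP hs (8 * (2 ^ d * L + 1))
  set M : ℝ := ((m : ℝ) + 1) ^ d with hM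
  have hM0 : 0 < M := by positivity
  refine ⟨2 * M ^ 2, by positivity, fun ψ hψ N x hx q hq hlast => ?_⟩
  have hψ0 : 0 ≤ ψ := le_trans (by positivity) hψ
  -- Only finitely many pairs occur, so one cutoff `T` serves them all, and `L` bounds the partial
  -- sums for every cutoff.
  have hev : ∀ᶠ T in atTop, ∀ i j : Fin N, -∑ t ∈ Finset.range T,
      (if cellIndex s (x j) ∈ cellBall (cellIndex s (x i)) t then b t else 0) ≤
        (φ (x i - x j)).toReal :=
    eventually_all.2 fun i => eventually_all.2 fun j => hlow (x i) (x j)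
  obtain ⟨T, hTx⟩ := hev.exists
  have hmain := inner_energy_lower_bound (cellIndex s ∘ x) (subcellIndex s m ∘ x)
    (fun i j => if i = j then 0 else (φ (x i - x j)).toReal) hK0 hψ0 b hb T (fun i => if_pos rfl)
    (fun i j hij h₁ h₂ => by
      rw [if_neg hij]
      exact hKφ _ (sub_ne_zero.2 (hx.ne hij)) (norm_sub_le_of_subcell_eq hs m h₁ h₂))
    (fun i j hij => by
      rw [if_neg hij]
      exact hTx i j) (hL T) hq hlast
  set S := sqCount (cellIndex s ∘ x) q with hS
  have hS0 : 0 ≤ S := sqCount_nonneg _ _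
  have hcardκ : ((Fintype.card (Fin d → Fin (m + 1)) : ℕ) : ℝ) = M := by
    simp [hM]
  -- The number of particles inside, the self-pair loss, must stay below `S / M`. Bound each `n_k`
  -- by `n_k² / (2M) + M / 2`; the density `ψ ≥ 2M²` makes the constants sum to at most `S / (4M)`,
  -- which leaves a quarter of `S / M`.
  have hcard : ((innerParticles (cellIndex s ∘ x) q).card : ℝ) ≤ S * (3 / (4 * M)) := by
    rw [card_innerParticles]
    have h₁ : ∀ k ∈ cellBall (0 : Fin d → ℤ) q, cellCount (cellIndex s ∘ x) k ≤
        cellCount (cellIndex s ∘ x) k ^ 2 / (2 * M) + M / 2 := by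
      intro k _
      set n := cellCount (cellIndex s ∘ x) k
      rw [div_add_div _ _ (by positivity) (by norm_num), le_div_iff₀ (by positivity)]
      nlinarith [sq_nonneg (n - M)]
    refine (Finset.sum_le_sum h₁).trans ?_
    rw [Finset.sum_add_distrib, ← Finset.sum_div, Finset.sum_const, card_cellBall, nsmul_eq_mul]
    change S / (2 * M) + _ ≤ _
    have hV : 2 * M ^ 2 * (2 * (q : ℝ) + 1) ^ d ≤ S :=
      (mul_le_mul_of_nonneg_right hψ (by positivity)).trans hq
    have h₂ : (2 * (q : ℝ) + 1) ^ d * (M / 2) ≤ S / (4 * M) := by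
      rw [le_div_iff₀ (by positivity)]
      nlinarith
    have h₃ : S / (2 * M) + S / (4 * M) = S * (3 / (4 * M)) := by
      field_simp
      ring
    push_cast
    linarith
  have hgain : (2 ^ d * L + 1) * S ≤
      K / 2 * (S / M - (innerParticles (cellIndex s ∘ x) q).card) := by
    have h₁ : S / (4 * M) ≤ S / M - (innerParticles (cellIndex s ∘ x) q).card := by
      have : S / M - S * (3 / (4 * M)) = S / (4 * M) := by
        field_simp
        ring
      linarith
    calc (2 ^ d * L + 1) * S = (8 * (2 ^ d * L + 1) * M) / 2 * (S / (4 * M)) := by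
          field_simp
          ring
      _ ≤ K / 2 * (S / (4 * M)) :=
          mul_le_mul_of_nonneg_right (by linarith) (by positivity)
      _ ≤ _ := mul_le_mul_of_nonneg_left h₁ (by linarith)
  rw [hcardκ] at hmain
  rw [pairEnergy_univ (v := fun y => (φ y).toReal) (fun y => by rw [hφ.even])
    (innerParticles (cellIndex s ∘ x) q)]
  have hmain' : K / 2 * (S / M - (innerParticles (cellIndex s ∘ x) q).card) - 2 ^ d * L * S ≤
      pairEnergy (fun y => (φ y).toReal) (innerParticles (cellIndex s ∘ x) q) x +
      ∑ i ∈ innerParticles (cellIndex s ∘ x) q, ∑ j ∈ (innerParticles (cellIndex s ∘ x) q)ᶜ,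
        if i = j then 0 else (φ (x i - x j)).toReal := by
    exact hmain
  linarith

end Superstability

/-! ### Insertion of a particle -/

section Insertion

variable {d : ℕ}

/-- Near the origin the region is compact and `v` is continuous on it; far out `v` is dominated by a
multiple of `(1 + ‖x‖)^(-l)`, integrable because `l > d`. -/
theorem integrableOn_of_tempered {v : Space d → ℝ} (hv : ContinuousOn v {0}ᶜ) (hm : Measurable v)
    {A R l : ℝ} (hl : (d : ℝ) < l) (hT : ∀ x : Space d, R ≤ ‖x‖ → |v x| ≤ A * ‖x‖ ^ (-l)) {δ : ℝ}
    (hδ : 0 < δ) : IntegrableOn v {x | δ ≤ ‖x‖} := by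
  set R' := max R 1 with hR'
  have hl0 : 0 < l := lt_of_le_of_lt (Nat.cast_nonneg d) hl
  have h₁ : IntegrableOn v ({x | δ ≤ ‖x‖} ∩ Metric.closedBall 0 R') := by
    have hc : IsCompact ({x : Space d | δ ≤ ‖x‖} ∩ Metric.closedBall 0 R') :=
      (isCompact_closedBall 0 R').inter_left (isClosed_le continuous_const continuous_norm)
    refine ContinuousOn.integrableOn_compact hc (hv.mono fun x hx => ?_)
    simp only [Set.mem_compl_iff, Set.mem_singleton_iff]
    rintro rfl
    have := hx.1
    simp only [Set.mem_ofPred_eq, norm_zero] at this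
    linarith
  have h₂ : IntegrableOn v {x : Space d | R' ≤ ‖x‖} := by
    have hi : Integrable fun x : Space d => |A| * 2 ^ l * (1 + ‖x‖) ^ (-l) :=
      (integrable_one_add_norm (by simpa using hl)).const_mul _
    refine hi.integrableOn.mono' hm.aestronglyMeasurable ?_
    rw [ae_restrict_iff' (measurableSet_le measurable_const measurable_norm)]
    refine Eventually.of_forall fun x hx => ?_
    have hx1 : 1 ≤ ‖x‖ := (le_max_right R 1).trans hx
    have hx0 : 0 < ‖x‖ := by linarith
    have h2 : ‖x‖ ^ (-l) ≤ ((1 + ‖x‖) / 2) ^ (-l) :=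
      Real.rpow_le_rpow_of_nonpos (by linarith) (by linarith) (by linarith)
    rw [Real.div_rpow (by linarith) (by norm_num), Real.rpow_neg (by norm_num : (0 : ℝ) ≤ 2),
      div_inv_eq_mul] at h2
    calc ‖v x‖ ≤ A * ‖x‖ ^ (-l) := hT x ((le_max_left R 1).trans hx)
      _ ≤ |A| * ‖x‖ ^ (-l) := mul_le_mul_of_nonneg_right (le_abs_self A) (by positivity)
      _ ≤ |A| * ((1 + ‖x‖) ^ (-l) * 2 ^ l) := mul_le_mul_of_nonneg_left h2 (abs_nonneg A)
      _ = _ := by ring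
  refine (h₁.union h₂).mono_set fun x hx => ?_
  rcases le_total ‖x‖ R' with h | h
  · exact Or.inl ⟨hx, by simpa using h⟩
  · exact Or.inr h

theorem exists_volume_ball_le (hd : 1 ≤ d) {ε : ℝ} (hε : 0 < ε) :
    ∃ δ : ℝ, 0 < δ ∧ ∀ y : Space d, volume (Metric.ball y δ) ≤ ENNReal.ofReal ε := by
  have : Nonempty (Fin d) := ⟨⟨0, hd⟩⟩
  set V := (volume (Metric.ball (0 : Space d) 1)).toReal with hV
  have hV0 : 0 ≤ V := ENNReal.toReal_nonneg
  have hpos : 0 < ε / (V + 1) := by positivity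
  refine ⟨min 1 (ε / (V + 1)), lt_min one_pos hpos, fun y => ?_⟩
  set δ := min 1 (ε / (V + 1)) with hδ
  have hδ0 : 0 < δ := lt_min one_pos hpos
  rw [Measure.addHaar_ball _ _ hδ0.le, ← ENNReal.ofReal_toReal (a := volume (Metric.ball _ _))
    measure_ball_lt_top.ne, ← ENNReal.ofReal_mul (by positivity)]
  refine ENNReal.ofReal_le_ofReal ?_
  have h₁ : δ ^ Module.finrank ℝ (Space d) ≤ δ := by
    refine pow_le_of_le_one hδ0.le (min_le_left _ _) ?_
    simp
    omega
  calc _ ≤ δ * V := mul_le_mul_of_nonneg_right h₁ hV0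
    _ ≤ ε / (V + 1) * V := mul_le_mul_of_nonneg_right (min_le_right _ _) hV0
    _ ≤ ε := by
      rw [div_mul_eq_mul_div, div_le_iff₀ (by positivity)]
      nlinarith

/-- A particle can be inserted among at most `κ |Λ|` others with a weight of order `|Λ|`. -/
theorem exists_insertion_bound (hd : 1 ≤ d) {v : Space d → ℝ} (hv : ContinuousOn v {0}ᶜ)
    (hm : Measurable v) {A R l β κ : ℝ} (hβ : 0 < β) (hκ : 0 < κ) (hl : (d : ℝ) < l)
    (hT : ∀ x : Space d, R ≤ ‖x‖ → |v x| ≤ A * ‖x‖ ^ (-l)) :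
    ∃ c : ℝ, 0 < c ∧ ∀ (Λ : Set (Space d)) (_ : MeasurableSet Λ) (_ : volume Λ ≠ ⊤)
      {ι : Type} (T : Finset ι) (_ : (T.card : ℝ) ≤ κ * (volume Λ).toReal) (y : ι → Space d),
      ENNReal.ofReal c * volume Λ ≤
        ∫⁻ z in Λ, ENNReal.ofReal (Real.exp (-(β * ∑ j ∈ T, v (z - y j)))) := by
  -- At most `κ |Λ|` balls of volume `1 / (2κ)` exclude at most half of `Λ`.
  obtain ⟨δ, hδ, hball⟩ := exists_volume_ball_le hd (show 0 < 1 / (2 * κ) by positivity)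
  have hint := integrableOn_of_tempered hv hm hl hT hδ
  set g : Space d → ℝ := {x | δ ≤ ‖x‖}.indicator fun x => |v x| with hg
  have hms : MeasurableSet {x : Space d | δ ≤ ‖x‖} :=
    measurableSet_le measurable_const measurable_norm
  have hgm : Measurable g := (hm.norm).indicator hms
  have hg0 : ∀ x, 0 ≤ g x := fun x => Set.indicator_nonneg (fun _ _ => abs_nonneg _) x
  have hgi : Integrable g := (integrable_indicator_iff hms).2 hint.norm
  set C := ∫ x, g x with hC
  have hC0 : 0 ≤ C := integral_nonneg hg0
  have hCl : ∀ y : Space d, ∫⁻ z, ENNReal.ofReal (g (z - y)) = ENNReal.ofReal C := by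
    intro y
    rw [lintegral_sub_right_eq_self (fun z => ENNReal.ofReal (g z)) y,
      ← ofReal_integral_eq_lintegral_ofReal hgi (Eventually.of_forall hg0)]
  -- Markov's inequality: the total interaction away from the excluded balls has integral at most `κ
  -- |Λ| C`, so it reaches `h` on volume at most `|Λ| / 4`. A quarter of `Λ` remains, where the
  -- weight is at least `exp(-β h)`. The `+ 1` keeps `h` positive.
  set h := 4 * κ * (C + 1) with hh
  have hh0 : 0 < h := by positivity
  refine ⟨Real.exp (-(β * h)) / 4, by positivity, fun Λ hΛm hΛf ι T hcard y => ?_⟩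
  set Vol := (volume Λ).toReal with hVol
  have hVolE : volume Λ = ENNReal.ofReal Vol := (ENNReal.ofReal_toReal hΛf).symm
  have hVol0 : 0 ≤ Vol := ENNReal.toReal_nonneg
  set S₁ : Set (Space d) := ⋃ j ∈ T, Metric.ball (y j) δ with hS₁
  set S₂ : Set (Space d) := {z | ENNReal.ofReal h ≤ ∑ j ∈ T, ENNReal.ofReal (g (z - y j))} with hS₂
  have hgm' : ∀ j, Measurable fun z => ENNReal.ofReal (g (z - y j)) := fun j =>
    (hgm.comp (measurable_id.sub_const _)).ennreal_ofReal
  have hS₁m : MeasurableSet S₁ := T.measurableSet_biUnion fun j _ => measurableSet_ball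
  have hS₂m : MeasurableSet S₂ :=
    measurableSet_le measurable_const (Finset.measurable_sum _ fun j _ => hgm' j)
  have hv₁ : volume S₁ ≤ ENNReal.ofReal (Vol / 2) := by
    refine (measure_biUnion_finset_le _ _).trans ((Finset.sum_le_sum fun j _ => hball (y j)).trans ?_)
    rw [Finset.sum_const, nsmul_eq_mul, ← ENNReal.ofReal_natCast,
        ← ENNReal.ofReal_mul (Nat.cast_nonneg _)]
    refine ENNReal.ofReal_le_ofReal ?_
    calc (T.card : ℝ) * (1 / (2 * κ)) ≤ κ * Vol * (1 / (2 * κ)) :=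
          mul_le_mul_of_nonneg_right hcard (by positivity)
      _ = _ := by field_simp
  have hv₂ : volume S₂ ≤ ENNReal.ofReal (Vol / 4) := by
    have h₁ := mul_meas_ge_le_lintegral (μ := volume)
      (Finset.measurable_sum T fun j _ => hgm' j) (ENNReal.ofReal h)
    have h₂ : ∫⁻ z, ∑ j ∈ T, ENNReal.ofReal (g (z - y j)) ≤ ENNReal.ofReal (h * (Vol / 4)) := by
      rw [lintegral_finsetSum _ fun j _ => hgm' j, Finset.sum_congr rfl fun j _ => hCl (y j),
        Finset.sum_const, nsmul_eq_mul, ← ENNReal.ofReal_natCast,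
        ← ENNReal.ofReal_mul (Nat.cast_nonneg _)]
      refine ENNReal.ofReal_le_ofReal ?_
      rw [hh]
      have : (T.card : ℝ) * C ≤ κ * Vol * C := mul_le_mul_of_nonneg_right hcard hC0
      nlinarith [mul_nonneg hκ.le hVol0]
    have h₃ := h₁.trans h₂
    rw [ENNReal.ofReal_mul hh0.le] at h₃
    exact (ENNReal.mul_le_mul_iff_right (by simpa using hh0) ENNReal.ofReal_ne_top).1 h₃
  have hgood : ENNReal.ofReal (Vol / 4) ≤ volume (Λ \ (S₁ ∪ S₂)) := by
    have h₁ : volume Λ ≤ volume (Λ \ (S₁ ∪ S₂)) + volume (S₁ ∪ S₂) := by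
      refine (measure_mono fun z hz => ?_).trans (measure_union_le _ _)
      by_cases hz' : z ∈ S₁ ∪ S₂
      · exact Or.inr hz'
      · exact Or.inl ⟨hz, hz'⟩
    have h₂ : volume (S₁ ∪ S₂) ≤ ENNReal.ofReal (3 / 4 * Vol) := by
      refine (measure_union_le _ _).trans ((add_le_add hv₁ hv₂).trans ?_)
      rw [← ENNReal.ofReal_add (by positivity) (by positivity)]
      exact ENNReal.ofReal_le_ofReal (by linarith)
    have h₃ := h₁.trans (add_le_add_right h₂ _)
    rw [hVolE, ← tsub_le_iff_right, ← ENNReal.ofReal_sub _ (by positivity)] at h₃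
    exact (ENNReal.ofReal_le_ofReal (by linarith)).trans h₃
  have hdiff : MeasurableSet (Λ \ (S₁ ∪ S₂)) := hΛm.diff (hS₁m.union hS₂m)
  calc ENNReal.ofReal (Real.exp (-(β * h)) / 4) * volume Λ
      = ENNReal.ofReal (Real.exp (-(β * h))) * ENNReal.ofReal (Vol / 4) := by
        rw [hVolE, ← ENNReal.ofReal_mul (by positivity), ← ENNReal.ofReal_mul (by positivity)]
        congr 1
        ring
    _ ≤ ENNReal.ofReal (Real.exp (-(β * h))) * volume (Λ \ (S₁ ∪ S₂)) := by gcongr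
    _ = ∫⁻ _z in Λ \ (S₁ ∪ S₂), ENNReal.ofReal (Real.exp (-(β * h))) :=
        (setLIntegral_const _ _).symm
    _ ≤ ∫⁻ z in Λ \ (S₁ ∪ S₂), ENNReal.ofReal (Real.exp (-(β * ∑ j ∈ T, v (z - y j)))) := by
        refine setLIntegral_mono_ae' hdiff (Eventually.of_forall fun z hz => ?_)
        refine ENNReal.ofReal_le_ofReal (Real.exp_le_exp.2 (neg_le_neg ?_))
        refine mul_le_mul_of_nonneg_left ?_ hβ.le
        have hz₁ : ∀ j ∈ T, δ ≤ ‖z - y j‖ := by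
          intro j hj
          by_contra hlt
          refine hz.2 (Or.inl (Set.mem_biUnion hj ?_))
          rw [Metric.mem_ball, dist_eq_norm]
          exact not_le.1 hlt
        have hz₂ : ∑ j ∈ T, ENNReal.ofReal (g (z - y j)) < ENNReal.ofReal h := by
          by_contra hle
          exact hz.2 (Or.inr (not_lt.1 hle))
        rw [← ENNReal.ofReal_sum_of_nonneg fun j _ => hg0 _, ENNReal.ofReal_lt_ofReal_iff hh0] at hz₂
        refine (Finset.sum_le_sum fun j hj => ?_).trans hz₂.le
        have : g (z - y j) = |v (z - y j)| :=
          Set.indicator_of_mem (s := {x : Space d | δ ≤ ‖x‖}) (hz₁ j hj) _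
        rw [this]
        exact le_abs_self _
    _ ≤ _ := lintegral_mono_set Set.sdiff_subset

end Insertion

/-! ### Removal of particles -/

section Removal

variable {ι : Type*} [Fintype ι] [DecidableEq ι] {E : Type*} [MeasurableSpace E]

/-- Resampling one coordinate of a product measure: the inner integral no longer depends on `x a`,
so the outer integration over that coordinate contributes only the total mass. -/
theorem lintegral_lintegral_update (ν : Measure E) [SigmaFinite ν] {f : (ι → E) → ℝ≥0∞}
    (hf : Measurable f) (a : ι) :
    ∫⁻ x, ∫⁻ z, f (Function.update x a z) ∂ν ∂(Measure.pi fun _ => ν) =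
      ν Set.univ * ∫⁻ x, f x ∂(Measure.pi fun _ => ν) := by
  set g : (ι → E) → ℝ≥0∞ := fun x => ∫⁻ z, f (Function.update x a z) ∂ν with hg
  have hgm : Measurable g := by
    exact Measurable.lintegral_prod_right' (f := fun p : (ι → E) × E =>
      f (Function.update p.1 a p.2)) (hf.comp measurable_update')
  have hgu : ∀ x z, g (Function.update x a z) = g x := fun x z => by simp [hg]
  have key : ∀ (h : (ι → E) → ℝ≥0∞), Measurable h → ∀ x₀ : ι → E,
      ∫⁻ x, h x ∂(Measure.pi fun _ => ν) = (∫⋯∫⁻_Finset.univ.erase a,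
        (fun x => ∫⁻ z, h (Function.update x a z) ∂ν) ∂(fun _ => ν)) x₀ := by
    intro h hh x₀
    rw [lintegral_eq_lmarginal_univ x₀, lmarginal_erase' h hh (Finset.mem_univ a)]
  rcases isEmpty_or_nonempty (ι → E) with he | ⟨⟨x₀⟩⟩
  · have h0 : (Measure.pi fun _ : ι => ν) = 0 := Measure.eq_zero_of_isEmpty _
    simp [h0]
  · change ∫⁻ x, g x ∂_ = _
    rw [key g hgm x₀, key f hf x₀]
    simp only [hgu, lintegral_const]
    change _ = _ * (∫⋯∫⁻_Finset.univ.erase a, g ∂fun _ => ν) x₀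
    rw [lmarginal, lmarginal, mul_comm]
    exact lintegral_mul_const _ (hgm.comp measurable_updateFinset)

end Removal

/-! ### Comparison of Boltzmann weights before and after deleting particles -/

section RemovalBound

/-- The Boltzmann weight of the particles with label in `T`. -/
def boltzmannWeight {ι : Type} [DecidableEq ι] {d : ℕ} (β : ℝ) (v : Space d → ℝ) (T : Finset ι) (x : ι → Space d) : ℝ≥0∞ :=
  ENNReal.ofReal (Real.exp (-(β * pairEnergy v T x)))

theorem measurable_boltzmannWeight {ι : Type} [DecidableEq ι] {d : ℕ} (β : ℝ) {v : Space d → ℝ} (hm : Measurable v) (T : Finset ι) :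
    Measurable (boltzmannWeight β v T) :=
  (Real.measurable_exp.comp ((measurable_pairEnergy hm T).const_mul β).neg).ennreal_ofReal

variable {ι : Type} [Fintype ι] [DecidableEq ι] {d : ℕ}

/-- Without particle `a` in the weight, its position is free and integrates to `ν A`. Integrating
the weight with `a` present over its position gains a factor of at least `c * ν univ` by `hc`. Both
sides are thus compared with the integral of `g` times the weight of `T`. -/
theorem lintegral_remove_particle {β : ℝ} {v : Space d → ℝ} (hm : Measurable v)
    (hv : ∀ x, v (-x) = v x) {ν : Measure (Space d)} [IsFiniteMeasure ν] {c : ℝ≥0∞}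
    {T : Finset ι} {a : ι} (ha : a ∉ T)
    (hc : ∀ y : ι → Space d, c * ν Set.univ ≤
      ∫⁻ z, ENNReal.ofReal (Real.exp (-(β * ∑ j ∈ T, v (z - y j)))) ∂ν)
    {A : Set (Space d)} (hA : MeasurableSet A) {g : (ι → Space d) → ℝ≥0∞} (hg : Measurable g)
    (hga : ∀ x z, g (Function.update x a z) = g x) :
    c * ν Set.univ * ∫⁻ x, A.indicator 1 (x a) * (g x * boltzmannWeight β v T x)
        ∂(Measure.pi fun _ => ν) ≤
      ν A * ∫⁻ x : ι → Space d, g x * boltzmannWeight β v (insert a T) x ∂(Measure.pi fun _ => ν) := by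
  have hwT := measurable_boltzmannWeight β hm T (ι := ι)
  have hwa := measurable_boltzmannWeight β hm (insert a T) (ι := ι)
  have hAm : Measurable fun x : ι → Space d => A.indicator (1 : Space d → ℝ≥0∞) (x a) :=
    (measurable_one.indicator hA).comp (measurable_pi_apply a)
  have hne : ∀ j ∈ T, j ≠ a := fun j hj h => ha (h ▸ hj)
  have hTu : ∀ x z, boltzmannWeight β v T (Function.update x a z) = boltzmannWeight β v T x := by
    intro x z
    simp only [boltzmannWeight]
    rw [pairEnergy_congr v fun i hi => Function.update_of_ne (hne i hi) z x]
  have hau : ∀ x z, boltzmannWeight β v (insert a T) (Function.update x a z) =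
      boltzmannWeight β v T x *
        ENNReal.ofReal (Real.exp (-(β * ∑ j ∈ T, v (z - x j)))) := by
    intro x z
    simp only [boltzmannWeight]
    rw [pairEnergy_insert hv ha, pairEnergy_congr v fun i hi => Function.update_of_ne (hne i hi) z x,
      ← ENNReal.ofReal_mul (Real.exp_nonneg _), ← Real.exp_add, Function.update_self,
      Finset.sum_congr rfl fun j hj => by rw [Function.update_of_ne (hne j hj) z x]]
    congr 2
    ring
  have hgT : Measurable fun x => g x * boltzmannWeight β v T x := hg.mul hwT
  have h₁ := lintegral_lintegral_update ν (hAm.mul (hg.mul hwT)) a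
  have h₂ := lintegral_lintegral_update ν (hg.mul hwa) a
  simp only [Pi.mul_apply, hga, hTu, hau, Function.update_self] at h₁ h₂
  have e₁ : ∀ x : ι → Space d, ∫⁻ z, A.indicator 1 z * (g x * boltzmannWeight β v T x) ∂ν =
      ν A * (g x * boltzmannWeight β v T x) := by
    intro x
    rw [lintegral_mul_const _ (measurable_one.indicator hA), lintegral_indicator_one hA]
  simp only [e₁] at h₁
  rw [lintegral_const_mul _ hgT] at h₁
  have e₂ : ν Set.univ * (c * ∫⁻ x, g x * boltzmannWeight β v T x ∂(Measure.pi fun _ => ν)) ≤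
      ν Set.univ * ∫⁻ x : ι → Space d, g x * boltzmannWeight β v (insert a T) x ∂(Measure.pi fun _ => ν) := by
    rw [← h₂, ← mul_assoc, mul_comm (ν Set.univ) c, ← lintegral_const_mul _ hgT]
    refine lintegral_mono fun x => ?_
    have hmz : Measurable fun z => ENNReal.ofReal (Real.exp (-(β * ∑ j ∈ T, v (z - x j)))) :=
      (Real.measurable_exp.comp ((Finset.measurable_sum _ fun j _ =>
        hm.comp (measurable_id.sub_const _)).const_mul β).neg).ennreal_ofReal
    simp only [← mul_assoc]
    rw [lintegral_const_mul _ hmz]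
    calc _ = (g x * boltzmannWeight β v T x) * (c * ν Set.univ) := by ring
      _ ≤ _ := by gcongr; exact hc x
  rcases eq_or_ne (ν Set.univ) 0 with h0 | h0
  · simp [h0]
  have e₃ := (ENNReal.mul_le_mul_iff_right h0 (measure_ne_top ν _)).1 e₂
  calc _ = c * (ν A * ∫⁻ x, g x * boltzmannWeight β v T x ∂(Measure.pi fun _ => ν)) := by
        rw [mul_assoc, ← h₁]
    _ = ν A * (c * ∫⁻ x, g x * boltzmannWeight β v T x ∂(Measure.pi fun _ => ν)) := by ring
    _ ≤ _ := by gcongr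

/-- Removing the particles with label in `I`, confined to `A`, costs at most
`(ν(A) / (c ν(Λ)))^|I|`. -/
theorem lintegral_remove_particles {β : ℝ} {v : Space d → ℝ} (hm : Measurable v)
    (hv : ∀ x, v (-x) = v x) {ν : Measure (Space d)} [IsFiniteMeasure ν] {p : ℝ≥0∞}
    {c : ℝ≥0∞} (hc0 : c ≠ 0) (hct : c ≠ ⊤) (hν : ν Set.univ ≠ 0)
    (hc : ∀ (T : Finset ι) (y : ι → Space d), c * ν Set.univ ≤
      ∫⁻ z, ENNReal.ofReal (Real.exp (-(β * ∑ j ∈ T, v (z - y j)))) ∂ν)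
    {A : Set (Space d)} (hA : MeasurableSet A) (hp : ν A ≤ p * (c * ν Set.univ)) (I : Finset ι) :
    ∫⁻ x, (∏ i ∈ I, A.indicator (1 : Space d → ℝ≥0∞) (x i)) * boltzmannWeight β v Iᶜ x
        ∂(Measure.pi fun _ => ν) ≤
      p ^ I.card * ∫⁻ x : ι → Space d, boltzmannWeight β v Finset.univ x ∂(Measure.pi fun _ => ν) := by
  induction I using Finset.induction_on with
  | empty => simp only [Finset.prod_empty, one_mul, Finset.compl_empty, Finset.card_empty, pow_zero,
      le_refl]
  | insert a I ha ih =>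
    have hT : a ∉ (insert a I)ᶜ := by simp
    -- Reinserting `a` into the survivors of `insert a I` leaves the survivors of `I`, to which the
    -- induction hypothesis applies.
    have hins : insert a (insert a I)ᶜ = Iᶜ := by
      ext i
      by_cases h : i = a
      · subst h
        simp [ha]
      · simp [h]
    have hgm : Measurable fun x : ι → Space d =>
        ∏ i ∈ I, A.indicator (1 : Space d → ℝ≥0∞) (x i) :=
      Finset.measurable_prod _ fun i _ =>
        (measurable_one.indicator hA).comp (measurable_pi_apply i)
    have h := lintegral_remove_particle (β := β) hm hv hT (hc _) hA hgm fun x z => by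
      refine Finset.prod_congr rfl fun i hi => ?_
      rw [Function.update_of_ne]
      rintro rfl
      exact ha hi
    rw [hins] at h
    have hcν0 : c * ν Set.univ ≠ 0 := mul_ne_zero hc0 hν
    have hcνt : c * ν Set.univ ≠ ⊤ := ENNReal.mul_ne_top hct (measure_ne_top ν _)
    refine (ENNReal.mul_le_mul_iff_right hcν0 hcνt).1 ?_
    simp only [Finset.prod_insert ha, mul_assoc] at h ⊢
    refine h.trans ?_
    calc _ ≤ p * (c * ν Set.univ) * (p ^ I.card *
          ∫⁻ x : ι → Space d, boltzmannWeight β v Finset.univ x ∂(Measure.pi fun _ => ν)) := by gcongr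
      _ = _ := by
        rw [Finset.card_insert_of_notMem ha]
        ring

end RemovalBound

/-! ### Uniform second moments of particle numbers -/

section Moments

variable {d : ℕ}

theorem measurable_cellIndex (s : ℝ) : Measurable (cellIndex s : Space d → Fin d → ℤ) := by
  refine measurable_pi_lambda _ fun a => Int.measurable_floor.comp ?_
  exact ((by fun_prop : Measurable fun x : Space d => x a).div_const s).add_const _

/-- The cube of cells is contained in the product of half-open intervals of length `s (2q + 1)`,
centred at the origin. -/
theorem volume_cellIndex_preimage_le {s : ℝ} (hs : 0 < s) (q : ℕ) :
    volume {x : Space d | cellIndex s x ∈ cellBall 0 q} ≤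
      ENNReal.ofReal (s ^ d * (2 * q + 1) ^ d) := by
  set J : Set (Fin d → ℝ) := Set.univ.pi fun _ =>
    Set.Ico (s * (-q - 1 / 2)) (s * (q + 1 / 2)) with hJ
  have hsub : {x : Space d | cellIndex s x ∈ cellBall 0 q} ⊆
      (WithLp.ofLp : Space d → Fin d → ℝ) ⁻¹' J := by
    intro x hx a _
    have h : |⌊x a / s + 1 / 2⌋| ≤ (q : ℤ) := by simpa [cellIndex] using mem_cellBall.1 hx a
    rw [abs_le] at h
    have h₁ : -(q : ℝ) ≤ ⌊x a / s + 1 / 2⌋ := by exact_mod_cast h.1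
    have h₂ : (⌊x a / s + 1 / 2⌋ : ℝ) ≤ q := by exact_mod_cast h.2
    have e₁ := Int.floor_le (x a / s + 1 / 2)
    have e₂ := Int.lt_floor_add_one (x a / s + 1 / 2)
    have hx' : x a = s * (x a / s) := by field_simp
    change x a ∈ Set.Ico _ _
    rw [hx']
    constructor
    · exact mul_le_mul_of_nonneg_left (by linarith) hs.le
    · exact mul_lt_mul_of_pos_left (by linarith) hs
  refine (measure_mono hsub).trans ?_
  rw [(PiLp.volume_preserving_ofLp (Fin d)).measure_preimage
    (MeasurableSet.univ_pi fun _ => measurableSet_Ico).nullMeasurableSet, Real.volume_pi_Ico, Finset.prod_const, ← ENNReal.ofReal_pow]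
  · refine ENNReal.ofReal_le_ofReal (le_of_eq ?_)
    rw [Finset.card_univ, Fintype.card_fin, ← mul_pow]
    congr 1
    ring
  · have : (0 : ℝ) ≤ q := Nat.cast_nonneg q
    nlinarith

/-- For `i ≠ j` the tuples with `x i = x j` form the kernel of a linear map that is nonzero because
`d ≥ 1`, and proper subspaces are null sets. -/
theorem ae_injective (hd : 1 ≤ d) (N : ℕ) :
    ∀ᵐ x : Fin N → Space d, Function.Injective x := by
  have : Nonempty (Fin d) := ⟨⟨0, hd⟩⟩
  have key : ∀ i j : Fin N, ∀ᵐ x : Fin N → Space d, i ≠ j → x i ≠ x j := by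
    intro i j
    by_cases hij : i = j
    · exact Eventually.of_forall fun x h => absurd hij h
    · set W : Submodule ℝ (Fin N → Space d) := LinearMap.ker
        (LinearMap.proj (R := ℝ) (φ := fun _ : Fin N => Space d) i - LinearMap.proj j) with hW
      have hne : W ≠ ⊤ := by
        intro h
        obtain ⟨z, hz⟩ := exists_ne (0 : Space d)
        have hm : Pi.single i z ∈ W := h ▸ Submodule.mem_top
        rw [hW, LinearMap.mem_ker] at hm
        have hji : j ≠ i := Ne.symm hij
        simp [hji] at hm
        exact hz hm
      have h0 := Measure.addHaar_submodule (volume : Measure (Fin N → Space d)) W hne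
      filter_upwards [compl_mem_ae_iff.2 h0] with x hx _ hxx
      refine hx ?_
      change x ∈ W
      rw [hW, LinearMap.mem_ker]
      simp [hxx]
  filter_upwards [ae_all_iff.2 fun i => ae_all_iff.2 fun j => key i j] with x hx i j hij
  by_contra h
  exact hx i j h hij

theorem sqCount_le_sq {N : ℕ} (r : Fin N → Fin d → ℤ) (q : ℕ) : sqCount r q ≤ (N : ℝ) ^ 2 := by
  have h₁ : ∀ k, cellCount r k ≤ N := by
    intro k
    refine (Finset.sum_le_sum (g := fun _ => (1 : ℝ)) fun i _ => ?_).trans (by simp)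
    split_ifs <;> norm_num
  have h₂ : ∑ k ∈ cellBall 0 q, cellCount r k ≤ N := by
    rw [← card_innerParticles]
    exact_mod_cast (Finset.card_le_univ _).trans (by simp)
  calc sqCount r q ≤ ∑ k ∈ cellBall 0 q, N * cellCount r k :=
        Finset.sum_le_sum fun k _ => by
          rw [pow_two]
          exact mul_le_mul_of_nonneg_right (h₁ k) (cellCount_nonneg r k)
    _ = N * ∑ k ∈ cellBall 0 q, cellCount r k := by rw [Finset.mul_sum]
    _ ≤ _ := by
      rw [pow_two]
      exact mul_le_mul_of_nonneg_left h₂ (Nat.cast_nonneg N)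

/-- A largest dense cube exists because `sqCount` never exceeds `N²`, whereas `ψ (2j + 1)^d` does so
once `j > N²`. The explicit bound on `q` keeps the later sum over `q` finite. -/
theorem exists_last_dense_cube {N : ℕ} (r : Fin N → Fin d → ℤ) (hd : 1 ≤ d) {ψ : ℝ} (hψ : 1 ≤ ψ)
    (h0 : ψ ≤ sqCount r 0) :
    ∃ q < N ^ 2 + 1, ψ * (2 * q + 1) ^ d ≤ sqCount r q ∧
      ∀ j : ℕ, q < j → sqCount r j ≤ ψ * (2 * j + 1) ^ d := by
  classical
  set P : ℕ → Prop := fun q => ψ * (2 * (q : ℝ) + 1) ^ d ≤ sqCount r q with hP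
  have hP0 : P 0 := by simpa [hP] using h0
  refine ⟨Nat.findGreatest P (N ^ 2), Nat.lt_succ_of_le (Nat.findGreatest_le _),
    Nat.findGreatest_spec (Nat.zero_le _) hP0, fun j hj => ?_⟩
  rcases le_or_gt j (N ^ 2) with hjN | hjN
  · exact (not_le.1 (Nat.findGreatest_is_greatest (P := P) hj hjN)).le
  · refine (sqCount_le_sq r j).trans ?_
    have h₁ : (N : ℝ) ^ 2 ≤ j := by exact_mod_cast hjN.le
    have h₂ : (2 * (j : ℝ) + 1) ≤ (2 * (j : ℝ) + 1) ^ d :=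
      le_self_pow₀ (by have : (0 : ℝ) ≤ j := Nat.cast_nonneg j; linarith) (by omega)
    have h₃ : (0 : ℝ) ≤ j := Nat.cast_nonneg j
    nlinarith

/-- Pointwise decomposition according to the last dense cube. -/
theorem count_mul_boltzmannWeight_le {N : ℕ} (hd : 1 ≤ d) {β s ψ : ℝ} (hβ : 0 < β) (hψ : 1 ≤ ψ)
    {v : Space d → ℝ} {x : Fin N → Space d}
    (hstab : ∀ q : ℕ, ψ * (2 * q + 1) ^ d ≤ sqCount (cellIndex s ∘ x) q →
      (∀ j, q < j → sqCount (cellIndex s ∘ x) j ≤ ψ * (2 * j + 1) ^ d) →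
      pairEnergy v (innerParticles (cellIndex s ∘ x) q)ᶜ x +
        sqCount (cellIndex s ∘ x) q ≤ pairEnergy v Finset.univ x) :
    boltzmannWeight β v Finset.univ x * ENNReal.ofReal (cellCount (cellIndex s ∘ x) 0 ^ 2) ≤
      ENNReal.ofReal ψ * boltzmannWeight β v Finset.univ x +
      ∑ q ∈ Finset.range (N ^ 2 + 1),
        ENNReal.ofReal (2 / β * Real.exp (-(β * ψ / 2 * (2 * q + 1) ^ d))) *
          ∑ I ∈ (Finset.univ : Finset (Fin N)).powerset,
            (∏ i ∈ I, {y : Space d | cellIndex s y ∈ cellBall 0 q}.indicator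
              (1 : Space d → ℝ≥0∞) (x i)) * boltzmannWeight β v Iᶜ x := by
  set r := cellIndex s ∘ x with hr
  have hS0 : sqCount r 0 = cellCount r 0 ^ 2 := by
    have : cellBall (0 : Fin d → ℤ) 0 = {0} := by
      ext k
      simp only [mem_cellBall, Finset.mem_singleton, funext_iff]
      simp
    rw [sqCount, this, Finset.sum_singleton]
  rcases lt_or_ge (sqCount r 0) ψ with hlt | hge
  · refine le_add_right ?_
    rw [mul_comm]
    gcongr
    rw [← hS0]
    exact hlt.le
  · obtain ⟨q, hqN, hq, hlast⟩ := exists_last_dense_cube r hd hψ hge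
    refine le_add_left ?_
    refine le_trans ?_ (Finset.single_le_sum (fun _ _ => zero_le) (Finset.mem_range.2 hqN))
    -- Of the sums over `q` and `I` only the term of the actual last dense cube and its actual
    -- particles is kept; its indicators all equal 1.
    set I := innerParticles r q with hI
    refine le_trans ?_ (mul_le_mul' le_rfl (Finset.single_le_sum (fun _ _ => zero_le)
      (Finset.mem_powerset.2 (Finset.subset_univ I))))
    have hprod : ∏ i ∈ I, {y : Space d | cellIndex s y ∈ cellBall 0 q}.indicator
        (1 : Space d → ℝ≥0∞) (x i) = 1 := by
      refine Finset.prod_eq_one fun i hi => ?_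
      have hi' : cellIndex s (x i) ∈ cellBall 0 q := by
        simpa [hI, innerParticles, hr] using hi
      exact Set.indicator_of_mem (s := {y : Space d | cellIndex s y ∈ cellBall 0 q}) hi' _
    rw [hprod, one_mul, boltzmannWeight, boltzmannWeight, ← ENNReal.ofReal_mul (Real.exp_nonneg _),
      ← ENNReal.ofReal_mul (by positivity)]
    refine ENNReal.ofReal_le_ofReal ?_
    set S := sqCount r q with hS
    have h0S : cellCount r 0 ^ 2 ≤ S :=
      Finset.single_le_sum (f := fun k => cellCount r k ^ 2) (fun _ _ => sq_nonneg _)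
        (mem_cellBall_self 0 q)
    -- Half of the energy gain `exp(-β S)` absorbs the factor `S`; the other half, by density of the
    -- cube, becomes the decay in the cube volume.
    have hSe : S ≤ 2 / β * Real.exp (β * S / 2) := by
      have h := Real.add_one_le_exp (β * S / 2)
      rw [div_mul_eq_mul_div, le_div_iff₀ hβ]
      linarith
    have hE := hstab q hq hlast
    have hexp : Real.exp (-(β * pairEnergy v Finset.univ x)) ≤
        Real.exp (-(β * S)) * Real.exp (-(β * pairEnergy v Iᶜ x)) := by
      rw [← Real.exp_add]
      refine Real.exp_le_exp.2 ?_
      have := mul_le_mul_of_nonneg_left hE hβ.le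
      linarith
    have hexp2 : Real.exp (-(β * S)) * Real.exp (β * S / 2) ≤
        Real.exp (-(β * ψ / 2 * (2 * q + 1) ^ d)) := by
      rw [← Real.exp_add]
      refine Real.exp_le_exp.2 ?_
      have := mul_le_mul_of_nonneg_left hq hβ.le
      linarith
    calc _ ≤ (Real.exp (-(β * S)) * Real.exp (-(β * pairEnergy v Iᶜ x))) *
          (2 / β * Real.exp (β * S / 2)) :=
          mul_le_mul hexp (h0S.trans hSe) (sq_nonneg _) (by positivity)
      _ = 2 / β * (Real.exp (-(β * S)) * Real.exp (β * S / 2)) *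
          Real.exp (-(β * pairEnergy v Iᶜ x)) := by ring
      _ ≤ _ := by gcongr

theorem box_restrict_eq_pi (Λ : Set (Space d)) (N : ℕ) :
    (volume : Measure (Fin N → Space d)).restrict (box Λ N) =
      Measure.pi fun _ => (volume : Measure (Space d)).restrict Λ := by
  rw [box, volume_pi, Measure.restrict_pi_pi]

theorem measurable_toReal_potential {φ : Space d → EReal} (hφ : IsPairPotential φ) :
    Measurable fun x => (φ x).toReal :=
  measurable_ereal_toReal.comp hφ.measurable

theorem exp_energy_eq_boltzmannWeight {φ : Space d → EReal} (hφ : IsPairPotential φ) (β : ℝ) {N : ℕ}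
    (x : Fin N → Space d) : ENNReal.ofReal (Real.exp (-(β * energy φ x))) =
      boltzmannWeight β (fun y => (φ y).toReal) Finset.univ x := by
  rw [boltzmannWeight, energy_eq_pairEnergy hφ.even]

theorem exists_density_bound {ρ : ℝ} {Λ : ℕ → Set (Space d)} (hΛ : IsVolumeSequence ρ Λ) :
    ∃ κ : ℝ, 0 < κ ∧ ∀ N : ℕ, 1 ≤ N → (N : ℝ) ≤ κ * (volume (Λ N)).toReal := by
  obtain ⟨κ, hκ⟩ := hΛ.tendsto.bddAbove_range
  refine ⟨max κ 1, lt_max_of_lt_right one_pos, fun N hN => ?_⟩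
  have h := hκ ⟨N, rfl⟩
  have hv : 0 < (volume (Λ N)).toReal :=
    ENNReal.toReal_pos (hΛ.volume_pos N hN).ne' (hΛ.bounded N hN).measure_lt_top.ne
  simp only at h
  rw [div_le_iff₀ hv] at h
  exact h.trans (mul_le_mul_of_nonneg_right (le_max_left _ _) hv.le)

/-- The squared particle number of a cube has uniformly bounded expectation under the canonical
Gibbs measures. -/
theorem exists_second_moment_bound (hd : 1 ≤ d) {β : ℝ} (hβ : 0 < β) {φ : Space d → EReal}
    (hφ : IsPairPotential φ) (hRP : Repulsive φ) (hT : Tempered φ) (hBB : BoundedFromBelow φ)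
    (hcont : ContinuousOn (fun x => (φ x).toReal) {0}ᶜ) {ρ : ℝ} {Λ : ℕ → Set (Space d)}
    (hΛ : IsVolumeSequence ρ Λ) {s : ℝ} (hs : 0 < s) :
    ∃ C : ℝ, 0 ≤ C ∧ ∀ N, 1 ≤ N →
      ∫⁻ x, ENNReal.ofReal (cellCount (cellIndex s ∘ x) 0 ^ 2) ∂(tupleGibbs β φ (Λ N) N) ≤
        ENNReal.ofReal C := by
  obtain ⟨κ, hκ, hκN⟩ := exists_density_bound hΛ
  obtain ⟨ψ₀, hψ₀, hstab⟩ := exists_superstability hd hφ hRP hT hBB hs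
  have hm := measurable_toReal_potential hφ
  have hev : ∀ x, (fun x => (φ x).toReal) (-x) = (fun x => (φ x).toReal) x := fun x => by
    simp only [hφ.even]
  obtain ⟨A, R, l, hR, hl, hA⟩ := hT
  obtain ⟨c, hc, hins⟩ := exists_insertion_bound hd hcont hm hβ hκ hl hA
  set v : Space d → ℝ := fun x => (φ x).toReal with hv
  -- By `N ≤ κ |Λ|`, confining a particle to the cube of radius `q` costs a factor `p = D (2q + 1)^d
  -- / N` relative to its insertion weight `c |Λ|`.
  set D : ℝ := κ * s ^ d / c with hD
  have hD0 : 0 < D := by positivity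
  -- Besides superstability, `ψ` must give `β ψ / 2 ≥ D + 1`, so that the energy gain beats the
  -- entropy `exp(D (2q + 1)^d)` with one power of `exp(-(2q + 1)^d)` to spare.
  set ψ : ℝ := max (max ψ₀ 1) (2 * (D + 1) / β) with hψ
  have hψ1 : 1 ≤ ψ := (le_max_right ψ₀ 1).trans (le_max_left _ _)
  have hψ2 : ψ₀ ≤ ψ := (le_max_left ψ₀ 1).trans (le_max_left _ _)
  have hψ3 : D + 1 ≤ β * ψ / 2 := by
    have : 2 * (D + 1) / β ≤ ψ := le_max_right _ _
    rw [div_le_iff₀ hβ] at this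
    linarith
  refine ⟨ψ + 4 / β, by positivity, fun N hN => ?_⟩
  have hN0 : (0 : ℝ) < N := by exact_mod_cast hN
  set ν : Measure (Space d) := volume.restrict (Λ N) with hν
  have hΛfin : volume (Λ N) ≠ ⊤ := (hΛ.bounded N hN).measure_lt_top.ne
  have hνuniv : ν Set.univ = volume (Λ N) := by rw [hν, Measure.restrict_apply_univ]
  have : IsFiniteMeasure ν := ⟨by rw [hνuniv]; exact hΛfin.lt_top⟩
  set Z := ∫⁻ x : Fin N → Space d, boltzmannWeight β v Finset.univ x ∂(Measure.pi fun _ => ν) with hZ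
  set Aq : ℕ → Set (Space d) := fun q => {y | cellIndex s y ∈ cellBall 0 q} with hAq
  have hAm : ∀ q, MeasurableSet (Aq q) := fun q =>
    measurable_cellIndex s (Finset.measurableSet (cellBall 0 q))
  have hmP : ∀ q (I : Finset (Fin N)), Measurable fun x : Fin N → Space d =>
      (∏ i ∈ I, (Aq q).indicator (1 : Space d → ℝ≥0∞) (x i)) * boltzmannWeight β v Iᶜ x :=
    fun q I => (Finset.measurable_prod I fun i _ =>
      (measurable_one.indicator (hAm q)).comp (measurable_pi_apply i)).mul
        (measurable_boltzmannWeight β hm Iᶜ)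
  have hrem : ∀ q (I : Finset (Fin N)),
      ∫⁻ x, (∏ i ∈ I, (Aq q).indicator (1 : Space d → ℝ≥0∞) (x i)) * boltzmannWeight β v Iᶜ x
        ∂(Measure.pi fun _ => ν) ≤ ENNReal.ofReal (D * (2 * q + 1) ^ d / N) ^ I.card * Z := by
    intro q I
    refine lintegral_remove_particles hm hev (c := ENNReal.ofReal c) (by simpa using hc)
      ENNReal.ofReal_ne_top (by rw [hνuniv]; exact (hΛ.volume_pos N hN).ne') (fun T y => ?_) (hAm q)
      ?_ I
    · rw [hνuniv]
      refine hins (Λ N) (hΛ.measurableSet N hN) hΛfin T ?_ y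
      refine le_trans ?_ (hκN N hN)
      exact_mod_cast (Finset.card_le_univ T).trans (by simp)
    · refine (Measure.restrict_apply_le _ _).trans ((volume_cellIndex_preimage_le hs q).trans ?_)
      rw [hνuniv, ← ENNReal.ofReal_toReal hΛfin, ← ENNReal.ofReal_mul hc.le,
        ← ENNReal.ofReal_mul (by positivity)]
      refine ENNReal.ofReal_le_ofReal ?_
      rw [div_mul_eq_mul_div, le_div_iff₀ hN0]
      have h₁ := mul_le_mul_of_nonneg_left (hκN N hN)
        (show 0 ≤ s ^ d * (2 * (q : ℝ) + 1) ^ d by positivity)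
      refine h₁.trans (le_of_eq ?_)
      rw [hD]
      field_simp
  have hsum : ∀ q, ∫⁻ x, ∑ I ∈ (Finset.univ : Finset (Fin N)).powerset,
      (∏ i ∈ I, (Aq q).indicator (1 : Space d → ℝ≥0∞) (x i)) * boltzmannWeight β v Iᶜ x
        ∂(Measure.pi fun _ => ν) ≤ ENNReal.ofReal (Real.exp (D * (2 * q + 1) ^ d)) * Z := by
    intro q
    rw [lintegral_finsetSum _ fun I _ => hmP q I]
    refine (Finset.sum_le_sum fun I _ => hrem q I).trans ?_
    rw [← Finset.sum_mul]
    gcongr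
    set p := D * (2 * (q : ℝ) + 1) ^ d / N with hp
    have hp0 : 0 ≤ p := by positivity
    -- The sum over all label sets is binomial, `∑ p^|I| = (1 + p)^N ≤ exp(N p)`, and the factor `N`
    -- cancels the one in `p`.
    have h₁ := Finset.sum_pow_mul_eq_add_pow (ENNReal.ofReal p) 1 (Finset.univ : Finset (Fin N))
    simp only [one_pow, mul_one, Finset.card_univ, Fintype.card_fin] at h₁
    rw [h₁, ← ENNReal.ofReal_one, ← ENNReal.ofReal_add hp0 zero_le_one,
      ← ENNReal.ofReal_pow (by positivity)]
    refine ENNReal.ofReal_le_ofReal ?_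
    calc (p + 1) ^ N ≤ Real.exp p ^ N := pow_le_pow_left₀ (by positivity) (Real.add_one_le_exp p) N
      _ = Real.exp (D * (2 * q + 1) ^ d) := by
        rw [← Real.exp_nat_mul, hp]
        congr 1
        field_simp
  have hbound : ∫⁻ x in box (Λ N) N, boltzmannWeight β v Finset.univ x *
      ENNReal.ofReal (cellCount (cellIndex s ∘ x) 0 ^ 2) ≤ ENNReal.ofReal (ψ + 4 / β) * Z := by
    have hae : ∀ᵐ x ∂(volume : Measure (Fin N → Space d)).restrict (box (Λ N) N),
        Function.Injective x := ae_restrict_of_ae (ae_injective hd N)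
    refine (lintegral_mono_ae (hae.mono fun x hx =>
      count_mul_boltzmannWeight_le hd hβ hψ1 (hstab ψ hψ2 N x hx))).trans ?_
    have hmI : ∀ q, Measurable fun x : Fin N → Space d =>
        ∑ I ∈ (Finset.univ : Finset (Fin N)).powerset,
          (∏ i ∈ I, (Aq q).indicator (1 : Space d → ℝ≥0∞) (x i)) * boltzmannWeight β v Iᶜ x :=
      fun q => Finset.measurable_sum _ fun I _ => hmP q I
    rw [box_restrict_eq_pi, lintegral_add_left
      ((measurable_boltzmannWeight β hm _).const_mul _), lintegral_const_mul _
      (measurable_boltzmannWeight β hm _), lintegral_finsetSum _ fun q _ => (hmI q).const_mul _,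
      ENNReal.ofReal_add (by positivity) (by positivity), add_mul]
    gcongr
    calc _ = ∑ q ∈ Finset.range (N ^ 2 + 1),
          ENNReal.ofReal (2 / β * Real.exp (-(β * ψ / 2 * (2 * q + 1) ^ d))) *
          ∫⁻ x, ∑ I ∈ (Finset.univ : Finset (Fin N)).powerset,
            (∏ i ∈ I, (Aq q).indicator (1 : Space d → ℝ≥0∞) (x i)) * boltzmannWeight β v Iᶜ x
              ∂(Measure.pi fun _ => ν) :=
          Finset.sum_congr rfl fun q _ => lintegral_const_mul _ (hmI q)
      -- The surviving factor `exp(-(2q + 1)^d) ≤ exp(-q)` is replaced by `2^(-q)`, whose sum is at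
      -- most 2; this yields the `4 / β`.
      _ ≤ ∑ q ∈ Finset.range (N ^ 2 + 1), ENNReal.ofReal (2 / β * (1 / 2) ^ q) * Z := by
          refine Finset.sum_le_sum fun q _ => (mul_le_mul' le_rfl (hsum q)).trans ?_
          rw [← mul_assoc, ← ENNReal.ofReal_mul (by positivity)]
          refine mul_le_mul' (ENNReal.ofReal_le_ofReal ?_) le_rfl
          rw [mul_assoc, ← Real.exp_add]
          refine mul_le_mul_of_nonneg_left ?_ (by positivity)
          have hV : (q : ℝ) ≤ (2 * (q : ℝ) + 1) ^ d := by
            have h0 : (0 : ℝ) ≤ q := Nat.cast_nonneg q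
            exact le_trans (by linarith) (le_self_pow₀ (by linarith) (by omega : d ≠ 0))
          have hV0 : (0 : ℝ) ≤ (2 * (q : ℝ) + 1) ^ d := by positivity
          calc Real.exp (-(β * ψ / 2 * (2 * q + 1) ^ d) + D * (2 * q + 1) ^ d)
              ≤ Real.exp (-(q : ℝ)) := Real.exp_le_exp.2 (by nlinarith)
            _ = (Real.exp 1)⁻¹ ^ q := by
              rw [Real.exp_neg, inv_pow, ← Real.exp_nat_mul, mul_one]
            _ ≤ (1 / 2) ^ q := by
              refine pow_le_pow_left₀ (by positivity) ?_ q
              rw [one_div]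
              exact inv_anti₀ two_pos (by linarith [Real.add_one_le_exp (1 : ℝ)])
      _ ≤ _ := by
          rw [← Finset.sum_mul, ← ENNReal.ofReal_sum_of_nonneg fun q _ => by positivity]
          gcongr
          rw [← Finset.mul_sum]
          have := sum_geometric_two_le (N ^ 2 + 1)
          calc _ ≤ 2 / β * 2 := mul_le_mul_of_nonneg_left this (by positivity)
            _ = _ := by ring
  have hZ' : partitionFunction β φ (Λ N) N = Z := by
    rw [partitionFunction, hZ, ← box_restrict_eq_pi]
    simp only [exp_energy_eq_boltzmannWeight hφ, hv]
  rw [tupleGibbs, lintegral_smul_measure, hZ']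
  simp only [exp_energy_eq_boltzmannWeight hφ]
  rw [lintegral_withDensity_eq_lintegral_mul_non_measurable _
    (measurable_boltzmannWeight β hm Finset.univ)
    (Eventually.of_forall fun x => ENNReal.ofReal_lt_top)]
  calc _ ≤ Z⁻¹ * (ENNReal.ofReal (ψ + 4 / β) * Z) := mul_le_mul' le_rfl hbound
    _ = ENNReal.ofReal (ψ + 4 / β) * (Z⁻¹ * Z) := by ring
    _ ≤ ENNReal.ofReal (ψ + 4 / β) * 1 := by gcongr; exact ENNReal.inv_mul_le_one _
    _ = _ := mul_one _

end Moments

/-! ### Pairings and cylinder functions -/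

section Pairing

variable {d : ℕ}

theorem continuous_pairing {f : Space d → ℝ} (hf : Continuous f) (hc : HasCompactSupport f) :
    Continuous (pairing f : Config d → ℝ) :=
  continuous_iInf_dom (i := (⟨f, hf, hc⟩ : {f : Space d → ℝ // Continuous f ∧ HasCompactSupport f}))
    continuous_induced_dom

theorem pairing_eq_sum {f : Space d → ℝ} {K : Set (Space d)} (hK : IsCompact K)
    (hf : Function.support f ⊆ K) (γ : Config d) :
    pairing f γ = ∑ x ∈ (γ.locallyFinite K hK).toFinset, f x := by
  refine finsum_mem_eq_sum_of_inter_support_eq f ?_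
  ext x
  simp only [Set.Finite.coe_toFinset, Set.mem_inter_iff]
  exact ⟨fun h => ⟨⟨h.1, hf h.2⟩, h.2⟩, fun h => ⟨h.1.1, h.2⟩⟩

theorem pairing_sum {κ : Type*} (s : Finset κ) (a : κ → ℝ) {f : κ → Space d → ℝ}
    (hc : ∀ k, HasCompactSupport (f k)) (γ : Config d) :
    pairing (fun x => ∑ k ∈ s, a k * f k x) γ = ∑ k ∈ s, a k * pairing (f k) γ := by
  set K := ⋃ k ∈ s, tsupport (f k) with hK
  have hKc : IsCompact K := s.isCompact_biUnion fun k _ => hc k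
  have hsub : ∀ k ∈ s, Function.support (f k) ⊆ K := fun k hk =>
    (subset_tsupport _).trans (Set.subset_biUnion_of_mem (u := fun k => tsupport (f k)) hk)
  rw [pairing_eq_sum hKc]
  · rw [Finset.sum_comm]
    refine Finset.sum_congr rfl fun k hk => ?_
    rw [pairing_eq_sum hKc (hsub k hk), Finset.mul_sum]
  · intro x hx
    obtain ⟨k, hk, hne⟩ := Finset.exists_ne_zero_of_sum_ne_zero hx
    exact hsub k hk (right_ne_zero_of_mul hne)

theorem pairing_sym {N : ℕ} (f : Space d → ℝ) {x : Fin N → Space d} (hx : Function.Injective x) :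
    pairing f (sym x) = ∑ i, f (x i) := by
  rw [pairing, sym, finsum_mem_range hx, finsum_eq_sum_of_fintype]

theorem isOpen_injective (N : ℕ) : IsOpen {x : Fin N → Space d | Function.Injective x} := by
  have h : {x : Fin N → Space d | Function.Injective x} =
      ⋂ p : {p : Fin N × Fin N // p.1 ≠ p.2}, {x | x p.1.1 ≠ x p.1.2} := by
    ext x
    simp only [Set.mem_iInter, Set.mem_ofPred_eq, Subtype.forall, Prod.forall]
    exact ⟨fun hx i j hij => hx.ne hij, fun h i j hij => by_contra fun hne => h i j hne hij⟩
  rw [h]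
  exact isOpen_iInter_of_finite fun p =>
    isOpen_ne_fun (continuous_apply _) (continuous_apply _)

/-- On injective tuples `⟨f, sym x⟩` is the continuous function `∑ f(xᵢ)`. At coincidences the range
forgets multiplicities, hence the restriction. -/
theorem continuousOn_sym (N : ℕ) :
    ContinuousOn (sym : (Fin N → Space d) → Config d) {x | Function.Injective x} := by
  rw [continuousOn_iff_continuous_domRestrict]
  refine continuous_iInf_rng.2 fun f => continuous_induced_rng.2 ?_
  have h : (pairing f.1 ∘ Set.domRestrict {x : Fin N → Space d | Function.Injective x} sym) =
      fun x => ∑ i, f.1 (x.1 i) := by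
    funext x
    exact pairing_sym f.1 x.2
  rw [h]
  exact continuous_finsetSum _ fun i _ =>
    f.2.1.comp ((continuous_apply i).comp continuous_subtype_val)

theorem continuous_gradient {f : Space d → ℝ} (hf : ContDiff ℝ ∞ f) : Continuous (gradient f) :=
  (InnerProductSpace.toDual ℝ (Space d)).symm.continuous.comp (hf.continuous_fderiv (by simp))

theorem hasCompactSupport_gradient {f : Space d → ℝ} (hc : HasCompactSupport f) :
    HasCompactSupport (gradient f) :=
  (hc.fderiv (𝕜 := ℝ)).comp_left (g := (InnerProductSpace.toDual ℝ (Space d)).symm) (map_zero _)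

theorem continuous_inner_gradient {f h : Space d → ℝ} (hf : ContDiff ℝ ∞ f) (hh : ContDiff ℝ ∞ h) :
    Continuous fun x => inner ℝ (gradient f x) (gradient h x) :=
  (continuous_gradient hf).inner (continuous_gradient hh)

theorem hasCompactSupport_inner_gradient {f h : Space d → ℝ} (hc : HasCompactSupport f) :
    HasCompactSupport fun x => (inner ℝ (gradient f x) (gradient h x) : ℝ) := by
  refine (hasCompactSupport_gradient hc).mono fun x hx => ?_
  intro h0
  refine hx ?_
  simp [h0]

namespace CylinderFunction

/-- The partial derivative `∂ⱼg(⟨f₁, γ⟩, …, ⟨fₙ, γ⟩)`. -/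
def outerDeriv (F : CylinderFunction d) (j : Fin F.n) (γ : Config d) : ℝ :=
  fderiv ℝ F.g (fun k => pairing (F.f k) γ) (Pi.single j 1)

theorem continuous_pairings (F : CylinderFunction d) :
    Continuous fun γ : Config d => fun k => pairing (F.f k) γ :=
  continuous_pi fun k => continuous_pairing (F.contDiff_f k).continuous (F.hasCompactSupport_f k)

theorem continuous_toFun (F : CylinderFunction d) : Continuous F.toFun :=
  F.contDiff_g.continuous.comp F.continuous_pairings

theorem continuous_outerDeriv (F : CylinderFunction d) (j : Fin F.n) :
    Continuous (F.outerDeriv j) :=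
  ((F.contDiff_g.continuous_fderiv (by simp)).comp F.continuous_pairings).clm_apply
    continuous_const

theorem exists_grad_bound (F : CylinderFunction d) :
    ∃ C : ℝ, 0 ≤ C ∧ ∀ γ x, ‖F.grad γ x‖ ≤ C := by
  obtain ⟨C, hC⟩ := F.bounded_g 1
  have hb : ∀ j, ∃ B : ℝ, ∀ x, ‖gradient (F.f j) x‖ ≤ B := fun j =>
    (continuous_gradient (F.contDiff_f j)).bounded_above_of_compact_support
      (hasCompactSupport_gradient (F.hasCompactSupport_f j))
  choose B hB using hb
  have hC0 : 0 ≤ C := (norm_nonneg _).trans (hC 0)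
  have hB0 : ∀ j, 0 ≤ B j := fun j => (norm_nonneg _).trans (hB j 0)
  refine ⟨∑ j, C * B j, Finset.sum_nonneg fun j _ => mul_nonneg hC0 (hB0 j), fun γ x => ?_⟩
  refine (norm_sum_le _ _).trans (Finset.sum_le_sum fun j _ => ?_)
  rw [norm_smul]
  refine mul_le_mul ?_ (hB j x) (norm_nonneg _) hC0
  refine (ContinuousLinearMap.le_opNorm _ _).trans ?_
  have h₁ := hC fun k => pairing (F.f k) γ
  rw [norm_iteratedFDeriv_one] at h₁
  have h₂ : ‖(Pi.single j 1 : Fin F.n → ℝ)‖ ≤ 1 := by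
    rw [Pi.norm_single, norm_one]
  calc _ ≤ C * 1 := mul_le_mul h₁ h₂ (norm_nonneg _) hC0
    _ = C := mul_one C

theorem exists_grad_eq_zero (F : CylinderFunction d) :
    ∃ r : ℝ, 0 < r ∧ ∀ γ x, r ≤ ‖x‖ → F.grad γ x = 0 := by
  have hK : IsCompact (⋃ j, tsupport (gradient (F.f j))) :=
    isCompact_iUnion fun j => hasCompactSupport_gradient (F.hasCompactSupport_f j)
  obtain ⟨r, hr, hsub⟩ := hK.isBounded.exists_pos_norm_lt
  refine ⟨r, hr, fun γ x hx => Finset.sum_eq_zero fun j _ => ?_⟩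
  have h0 : gradient (F.f j) x = 0 := by
    by_contra hne
    have := hsub x (Set.mem_iUnion_of_mem j (subset_tsupport _ hne))
    linarith
  rw [h0, smul_zero]

end CylinderFunction

/-- The paired function itself depends on `γ`; bilinear expansion separates this dependence into
outer derivatives times pairings with fixed test functions. Continuity in the vague topology can be
read off from this form. -/
theorem squareField_eq (F G : CylinderFunction d) (γ : Config d) :
    squareField F G γ = ∑ p : Fin F.n × Fin G.n, F.outerDeriv p.1 γ * G.outerDeriv p.2 γ *
      pairing (fun x => inner ℝ (gradient (F.f p.1) x) (gradient (G.f p.2) x)) γ := by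
  rw [← pairing_sum _ _ fun p : Fin F.n × Fin G.n =>
    hasCompactSupport_inner_gradient (F.hasCompactSupport_f p.1), squareField]
  congr 1
  funext x
  simp only [CylinderFunction.grad, sum_inner, inner_sum, real_inner_smul_left,
    real_inner_smul_right, CylinderFunction.outerDeriv]
  rw [Fintype.sum_prod_type, Finset.sum_comm]
  refine Finset.sum_congr rfl fun j _ => Finset.sum_congr rfl fun k _ => ?_
  ring

theorem continuous_squareField (F G : CylinderFunction d) :
    Continuous (squareField F G) := by
  have h : squareField F G = fun γ => ∑ p : Fin F.n × Fin G.n,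
      F.outerDeriv p.1 γ * G.outerDeriv p.2 γ *
      pairing (fun x => inner ℝ (gradient (F.f p.1) x) (gradient (G.f p.2) x)) γ :=
    funext (squareField_eq F G)
  rw [h]
  exact continuous_finsetSum _ fun p _ => ((F.continuous_outerDeriv p.1).mul
    (G.continuous_outerDeriv p.2)).mul (continuous_pairing
      (continuous_inner_gradient (F.contDiff_f p.1) (G.contDiff_f p.2))
      (hasCompactSupport_inner_gradient (F.hasCompactSupport_f p.1)))

/-- The gradients are bounded and vanish outside a ball of radius `r`, which the central cell of
side `2r` contains. This reduces the second moment of the square field to that of one cell number.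
-/
theorem exists_squareField_sym_bound (F G : CylinderFunction d) :
    ∃ (s C : ℝ), 0 < s ∧ 0 ≤ C ∧ ∀ (N : ℕ) (x : Fin N → Space d), Function.Injective x →
      |squareField F G (sym x)| ≤ C * cellCount (cellIndex s ∘ x) 0 := by
  obtain ⟨CF, hCF0, hCF⟩ := F.exists_grad_bound
  obtain ⟨CG, hCG0, hCG⟩ := G.exists_grad_bound
  obtain ⟨r, hr, hz⟩ := F.exists_grad_eq_zero
  refine ⟨2 * r, CF * CG, by positivity, by positivity, fun N x hx => ?_⟩
  rw [squareField, pairing_sym _ hx, cellCount, Finset.mul_sum]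
  refine (Finset.abs_sum_le_sum_abs _ _).trans (Finset.sum_le_sum fun i _ => ?_)
  split_ifs with h
  · rw [mul_one]
    exact (abs_real_inner_le_norm _ _).trans
      (mul_le_mul (hCF _ _) (hCG _ _) (norm_nonneg _) hCF0)
  · have hxr : r ≤ ‖x i‖ := by
      by_contra hlt
      refine h (funext fun a => ?_)
      have h₁ : |x i a| < r := (PiLp.norm_apply_le (x i) a).trans_lt (not_le.1 hlt)
      rw [abs_lt] at h₁
      change ⌊x i a / (2 * r) + 1 / 2⌋ = 0
      rw [Int.floor_eq_zero_iff, Set.mem_Ico]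
      constructor
      · have : -(1 / 2) ≤ x i a / (2 * r) := by
          rw [le_div_iff₀ (by positivity)]
          linarith
        linarith
      · have : x i a / (2 * r) < 1 / 2 := by
          rw [div_lt_iff₀ (by positivity)]
          linarith
        linarith
    rw [hz _ _ hxr, inner_zero_left, abs_zero, mul_zero]

end Pairing

/-! ### Finite volume Gibbs measures -/

section Gibbs

variable {d : ℕ} {β : ℝ} {φ : Space d → EReal} {Λ : Set (Space d)} {N : ℕ}

theorem exists_energy_lower_bound (hφ : IsPairPotential φ) (hBB : BoundedFromBelow φ) (N : ℕ) :
    ∃ C : ℝ, ∀ x : Fin N → Space d, C ≤ energy φ x := by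
  obtain ⟨B, hB0, hB⟩ := hBB
  refine ⟨∑ i : Fin N, ∑ j ∈ Finset.Ioi i, -B, fun x =>
    Finset.sum_le_sum fun i _ => Finset.sum_le_sum fun j _ => ?_⟩
  rcases eq_or_ne (φ (x i - x j)) ⊤ with h | h
  · rw [h, EReal.toReal_top]
    linarith
  · have := hB (x i - x j)
    rw [← EReal.coe_toReal h (hφ.ne_bot _)] at this
    exact_mod_cast this

theorem measurable_energy (hφ : IsPairPotential φ) :
    Measurable (energy φ : (Fin N → Space d) → ℝ) := by
  unfold energy
  exact Finset.measurable_sum _ fun i _ => Finset.measurable_sum _ fun j _ =>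
    (measurable_toReal_potential hφ).comp ((measurable_pi_apply i).sub (measurable_pi_apply j))

theorem measurable_exp_energy (hφ : IsPairPotential φ) (β : ℝ) :
    Measurable fun x : Fin N → Space d => ENNReal.ofReal (Real.exp (-(β * energy φ x))) :=
  (Real.measurable_exp.comp ((measurable_energy hφ).const_mul β).neg).ennreal_ofReal

theorem partitionFunction_ne_top (hβ : 0 < β) (hφ : IsPairPotential φ) (hBB : BoundedFromBelow φ)
    (hΛ : volume (box Λ N) ≠ ⊤) : partitionFunction β φ Λ N ≠ ⊤ := by
  obtain ⟨C, hC⟩ := exists_energy_lower_bound hφ hBB N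
  refine ne_top_of_le_ne_top (ENNReal.mul_ne_top ENNReal.ofReal_ne_top hΛ)
    (b := ENNReal.ofReal (Real.exp (-(β * C))) * volume (box Λ N)) ?_
  rw [← setLIntegral_const]
  refine lintegral_mono fun x => ENNReal.ofReal_le_ofReal (Real.exp_le_exp.2 (neg_le_neg ?_))
  exact mul_le_mul_of_nonneg_left (hC x) hβ.le

theorem partitionFunction_ne_zero (hφ : IsPairPotential φ) (hΛ : volume (box Λ N) ≠ 0) :
    partitionFunction β φ Λ N ≠ 0 := by
  rw [partitionFunction, Ne, lintegral_eq_zero_iff (measurable_exp_energy hφ β)]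
  intro h
  have hne : (volume.restrict (box Λ N) : Measure (Fin N → Space d)) ≠ 0 := by
    rwa [Ne, Measure.restrict_eq_zero]
  refine hne (ae_eq_bot.1 (eventually_false_iff_eq_bot.1 (h.mono fun x hx => ?_)))
  simp only [Pi.zero_apply, ENNReal.ofReal_eq_zero] at hx
  exact absurd hx (not_le.2 (Real.exp_pos _))

theorem isProbabilityMeasure_tupleGibbs (hβ : 0 < β) (hφ : IsPairPotential φ)
    (hBB : BoundedFromBelow φ) (hΛ₀ : volume (box Λ N) ≠ 0) (hΛ : volume (box Λ N) ≠ ⊤) :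
    IsProbabilityMeasure (tupleGibbs β φ Λ N) := by
  refine ⟨?_⟩
  rw [tupleGibbs, Measure.smul_apply, withDensity_apply _ MeasurableSet.univ, Measure.restrict_univ,
    smul_eq_mul]
  exact ENNReal.inv_mul_cancel (partitionFunction_ne_zero hφ hΛ₀)
    (partitionFunction_ne_top hβ hφ hBB hΛ)

theorem tupleGibbs_absolutelyContinuous :
    tupleGibbs β φ Λ N ≪ volume.restrict (box Λ N) :=
  (withDensity_absolutelyContinuous _ _).smul_left _

theorem ae_injective_tupleGibbs (hd : 1 ≤ d) :
    ∀ᵐ x ∂(tupleGibbs β φ Λ N), Function.Injective x :=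
  tupleGibbs_absolutelyContinuous.ae_le (ae_restrict_of_ae (ae_injective hd N))

/-- `sym` is continuous on the open set of injective tuples, which has full measure. -/
theorem aemeasurable_sym (hd : 1 ≤ d) : AEMeasurable sym (tupleGibbs β φ Λ N) := by
  have h := (continuousOn_sym (d := d) N).aemeasurable (μ := tupleGibbs β φ Λ N)
    (isOpen_injective N).measurableSet
  rwa [Measure.restrict_eq_self_of_ae_mem (s := {x | Function.Injective x})
    (ae_injective_tupleGibbs hd)] at h

theorem box_volume {Λ : ℕ → Set (Space d)} {ρ : ℝ} (hΛ : IsVolumeSequence ρ Λ) (hN : 1 ≤ N) :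
    volume (box (Λ N) N) ≠ 0 ∧ volume (box (Λ N) N) ≠ ⊤ := by
  rw [box, volume_pi_pi]
  simp only [Finset.prod_const]
  exact ⟨pow_ne_zero _ (hΛ.volume_pos N hN).ne',
    ENNReal.pow_ne_top (hΛ.bounded N hN).measure_lt_top.ne⟩

end Gibbs

/-! ### Closability and the gradient of the closed form -/

section Closability

variable {d : ℕ} {β : ℝ} {φ : Space d → EReal} {Λ : Set (Space d)} {N : ℕ}

/-- The interior of `Λ^N` without the diagonals. -/
def regularPart (Λ : Set (Space d)) (N : ℕ) : Set (Fin N → Space d) :=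
  interior (box Λ N) ∩ {x | Function.Injective x}

theorem isOpen_regularPart : IsOpen (regularPart Λ N) := isOpen_interior.inter (isOpen_injective N)

theorem regularPart_subset_box : regularPart Λ N ⊆ box Λ N :=
  Set.inter_subset_left.trans interior_subset

theorem IsRegularVolume.isCompact_box (h : IsRegularVolume Λ N) : IsCompact (box Λ N) := by
  obtain ⟨O, -, hO, he⟩ := h.closure_open
  rw [he]
  exact hO

/-- The boundary of the box is null by regularity and the diagonals are null, so test functions
supported in the regular part see the Gibbs measure completely. -/
theorem ae_mem_regularPart (hd : 1 ≤ d) (h : IsRegularVolume Λ N) :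
    ∀ᵐ x ∂(tupleGibbs β φ Λ N), x ∈ regularPart Λ N := by
  have h₁ : ∀ᵐ x ∂(volume.restrict (box Λ N) : Measure (Fin N → Space d)), x ∈ regularPart Λ N := by
    filter_upwards [ae_restrict_mem h.isCompact_box.measurableSet,
      ae_restrict_of_ae (ae_injective hd N),
      ae_restrict_of_ae (compl_mem_ae_iff.2 h.frontier_null)] with x hx hinj hfr
    refine ⟨?_, hinj⟩
    by_contra hint
    exact hfr ⟨subset_closure hx, hint⟩
  exact tupleGibbs_absolutelyContinuous.ae_le h₁

theorem continuousOn_energy (hcont : ContinuousOn (fun x => (φ x).toReal) {0}ᶜ) :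
    ContinuousOn (energy φ) {x : Fin N → Space d | Function.Injective x} := by
  unfold energy
  refine continuousOn_finsetSum _ fun i _ => continuousOn_finsetSum _ fun j hj => ?_
  refine hcont.comp (f := fun x : Fin N → Space d => x i - x j)
    ((continuous_apply i).sub (continuous_apply j)).continuousOn fun x hx => ?_
  have hij : i ≠ j := (Finset.mem_Ioi.1 hj).ne
  exact sub_ne_zero.2 (Function.Injective.ne hx hij)

/-- On compact sets away from the diagonals, Lebesgue measure is dominated by the Gibbs measure. -/
theorem exists_volume_restrict_le (hβ : 0 < β) (hφ : IsPairPotential φ) (hBB : BoundedFromBelow φ)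
    (hcont : ContinuousOn (fun x => (φ x).toReal) {0}ᶜ) (hΛ₀ : volume (box Λ N) ≠ 0)
    (hΛ : volume (box Λ N) ≠ ⊤) {K : Set (Fin N → Space d)} (hK : IsCompact K)
    (hsub : K ⊆ regularPart Λ N) :
    ∃ C : ℝ≥0∞, C ≠ ⊤ ∧ volume.restrict K ≤ C • tupleGibbs β φ Λ N := by
  obtain ⟨M, hM⟩ := hK.exists_bound_of_continuousOn
    ((continuousOn_energy hcont).mono (hsub.trans Set.inter_subset_right))
  set Z := partitionFunction β φ Λ N with hZ
  have hZ0 : Z ≠ 0 := partitionFunction_ne_zero hφ hΛ₀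
  have hZt : Z ≠ ⊤ := partitionFunction_ne_top hβ hφ hBB hΛ
  -- On `K` the energy is at most `M`, so the unnormalized density is at least `exp(-β M)`; the
  -- factor `Z` undoes the normalization.
  refine ⟨ENNReal.ofReal (Real.exp (β * M)) * Z, ENNReal.mul_ne_top ENNReal.ofReal_ne_top hZt, ?_⟩
  refine Measure.le_iff.2 fun s hs => ?_
  have hsK : MeasurableSet (s ∩ K) := hs.inter hK.measurableSet
  rw [Measure.restrict_apply hs, tupleGibbs, Measure.smul_apply, Measure.smul_apply,
    withDensity_apply _ hs, Measure.restrict_restrict hs, smul_eq_mul, smul_eq_mul, ← hZ, mul_assoc,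
    ← mul_assoc Z, ENNReal.mul_inv_cancel hZ0 hZt, one_mul,
    ← lintegral_const_mul _ (measurable_exp_energy hφ β)]
  calc volume (s ∩ K) = ∫⁻ _x in s ∩ K, 1 := by rw [setLIntegral_const, one_mul]
    _ ≤ ∫⁻ x in s ∩ K, ENNReal.ofReal (Real.exp (β * M)) *
        ENNReal.ofReal (Real.exp (-(β * energy φ x))) := by
      refine setLIntegral_mono_ae' hsK (Eventually.of_forall fun x hx => ?_)
      rw [← ENNReal.ofReal_mul (Real.exp_nonneg _), ← Real.exp_add, ← ENNReal.ofReal_one]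
      refine ENNReal.ofReal_le_ofReal (Real.one_le_exp ?_)
      have h₁ := (Real.le_norm_self _).trans (hM x hx.2)
      have h₂ := mul_le_mul_of_nonneg_left h₁ hβ.le
      linarith
    _ ≤ _ := lintegral_mono_set
      (Set.inter_subset_inter_right _ (hsub.trans regularPart_subset_box))

/-- This transfers `L²(P)` limits to distributional pairings with respect to `m`: convergence in
`L²(P)` gives convergence in `L¹(P)`, hence in `L¹(m)` on `K` by domination, and `g` is bounded and
vanishes outside `K`. -/
theorem tendsto_integral_smul_of_eLpNorm {X E : Type*} [MeasurableSpace X] [TopologicalSpace X]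
    [NormedAddCommGroup E] [NormedSpace ℝ E] [OpensMeasurableSpace X]
    {m P : Measure X} [IsProbabilityMeasure P] {K : Set X} {C : ℝ≥0∞}
    (hC : C ≠ ⊤) (hKP : m.restrict K ≤ C • P) {f : X → E} (hf : MemLp f 2 P) {w : ℕ → X → E}
    (hw : ∀ k, IntegrableOn (w k) K m)
    (hw' : ∀ k, AEStronglyMeasurable (w k) P)
    (hlim : Tendsto (fun k => eLpNorm (w k - f) 2 P) atTop (𝓝 0)) {g : X → ℝ}
    (hg : Continuous g) {B : ℝ} (hB : ∀ x, ‖g x‖ ≤ B) (hgK : ∀ x ∉ K, g x = 0) :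
    Tendsto (fun k => ∫ x, g x • w k x ∂m) atTop (𝓝 (∫ x, g x • f x ∂m)) := by
  have hset : ∀ h : X → E, ∫ x, g x • h x ∂m = ∫ x in K, g x • h x ∂m := fun h =>
    (setIntegral_eq_integral_of_forall_compl_eq_zero fun x hx => by simp [hgK x hx]).symm
  have hfP : Integrable f P := hf.integrable (by norm_num)
  have hfK : IntegrableOn f K m := (hfP.smul_measure hC).mono_measure hKP
  have hgm : AEStronglyMeasurable g (m.restrict K) := hg.measurable.aestronglyMeasurable
  have hgI : ∀ {h : X → E}, IntegrableOn h K m → Integrable (fun x => g x • h x) (m.restrict K) :=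
    fun hh => hh.bdd_smul B hgm (Eventually.of_forall hB)
  simp only [hset]
  refine tendsto_integral_of_L1' _ (hgI hfK).aestronglyMeasurable
    (Eventually.of_forall fun k => hgI (hw k)) ?_
  have hbound : ∀ k, eLpNorm ((fun x => g x • w k x) - fun x => g x • f x) 1 (m.restrict K) ≤
      ENNReal.ofReal B * C * eLpNorm (w k - f) 2 P := by
    intro k
    calc _ ≤ ENNReal.ofReal B * eLpNorm (w k - f) 1 (m.restrict K) := by
          refine eLpNorm_le_mul_eLpNorm_of_ae_le_mul (Eventually.of_forall fun x => ?_) 1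
          simp only [Pi.sub_apply]
          rw [← smul_sub, norm_smul]
          exact mul_le_mul_of_nonneg_right (hB x) (norm_nonneg _)
      _ ≤ ENNReal.ofReal B * eLpNorm (w k - f) 1 (C • P) := by
          gcongr
      _ = ENNReal.ofReal B * (C * eLpNorm (w k - f) 1 P) := by
          rw [eLpNorm_one_smul_measure]
      _ ≤ ENNReal.ofReal B * (C * eLpNorm (w k - f) 2 P) := by
          gcongr
          exact eLpNorm_le_eLpNorm_of_exponent_le (by norm_num)
            ((hw' k).sub hf.aestronglyMeasurable)
      _ = _ := by rw [mul_assoc]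
  have h0 := ENNReal.Tendsto.const_mul hlim
    (Or.inr (ENNReal.mul_ne_top (ENNReal.ofReal_ne_top (r := B)) hC))
  rw [mul_zero] at h0
  exact tendsto_of_tendsto_of_tendsto_of_le_of_le tendsto_const_nhds h0 (fun _ => zero_le) hbound

/-- The gradient of a function in the domain of the closed form is its weak gradient away from
the diagonals. -/
theorem IsClosedGradient.integral_eq (hβ : 0 < β) (hφ : IsPairPotential φ)
    (hBB : BoundedFromBelow φ) (hcont : ContinuousOn (fun x => (φ x).toReal) {0}ᶜ)
    (hΛ₀ : volume (box Λ N) ≠ 0) (hΛ : volume (box Λ N) ≠ ⊤) (hreg : IsRegularVolume Λ N)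
    {u : (Fin N → Space d) → ℝ} {V : Fin N → (Fin N → Space d) → Space d}
    (hV : IsClosedGradient β φ Λ N u V) (i : Fin N) {ψ : (Fin N → Space d) → ℝ}
    (hψ : ContDiff ℝ ∞ ψ) (hc : HasCompactSupport ψ) (hs : tsupport ψ ⊆ regularPart Λ N)
    (h : Space d) :
    ∫ x, fderiv ℝ ψ x (LinearMap.single ℝ (fun _ : Fin N => Space d) i h) * u x =
      -inner ℝ (∫ x, ψ x • V i x) h := by
  have := isProbabilityMeasure_tupleGibbs hβ hφ hBB hΛ₀ hΛ
  obtain ⟨w, W, hwW, hw, hW⟩ := hV.approx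
  have hK : IsCompact (tsupport ψ) := hc
  obtain ⟨C, hC, hKP⟩ := exists_volume_restrict_le hβ hφ hBB hcont hΛ₀ hΛ hK hs
  have hsub : tsupport ψ ⊆ interior (box Λ N) := hs.trans Set.inter_subset_left
  set g : (Fin N → Space d) → ℝ := fun x =>
    fderiv ℝ ψ x (LinearMap.single ℝ (fun _ : Fin N => Space d) i h) with hg
  have hgcont : Continuous g := (hψ.continuous_fderiv (by simp)).clm_apply continuous_const
  have hg0 : ∀ x ∉ tsupport ψ, g x = 0 := by
    intro x hx
    have : fderiv ℝ ψ x = 0 := by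
      by_contra hne
      exact hx (tsupport_fderiv_subset ℝ (subset_tsupport _ hne))
    simp [hg, this]
  have hψ0 : ∀ x ∉ tsupport ψ, ψ x = 0 := fun x hx => image_eq_zero_of_notMem_tsupport hx
  have hgc : HasCompactSupport g := HasCompactSupport.intro hK hg0
  obtain ⟨B₁, hB₁⟩ := hgcont.bounded_above_of_compact_support hgc
  obtain ⟨B₂, hB₂⟩ := hψ.continuous.bounded_above_of_compact_support hc
  have hwm : ∀ k, AEStronglyMeasurable (w k) (tupleGibbs β φ Λ N) := fun k =>
    ((hwW k).continuousOn.aestronglyMeasurable hreg.isCompact_box.measurableSet).mono_ac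
      tupleGibbs_absolutelyContinuous
  have hwI : ∀ k, IntegrableOn (w k) (tsupport ψ) := fun k =>
    ((hwW k).weakGradient i).locallyIntegrable.integrableOn_compact_subset hsub hK
  have hWI : ∀ k, IntegrableOn (W k i) (tsupport ψ) := fun k =>
    ((hwW k).weakGradient i).locallyIntegrable_grad.integrableOn_compact_subset hsub hK
  have t₁ := tendsto_integral_smul_of_eLpNorm hC hKP hV.memLp hwI hwm hw hgcont
    hB₁ hg0
  have t₂ := tendsto_integral_smul_of_eLpNorm hC hKP (hV.memLp_grad i) hWI
    (fun k => ((hwW k).memLp i).aestronglyMeasurable) (hW i) hψ.continuous hB₂ hψ0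
  have t₃ := (Filter.Tendsto.inner (𝕜 := ℝ) t₂ (tendsto_const_nhds (x := h))).neg
  -- Both sides are limits of the two sides of the integration by parts formula of the core
  -- functions `w k`, which agree for every `k`.
  refine tendsto_nhds_unique t₁ (t₃.congr fun k => ?_)
  have hk := ((hwW k).weakGradient i).integral_eq ψ hψ hc hsub h
  rw [setIntegral_eq_integral_of_forall_compl_eq_zero fun x hx => by
      rw [show fderiv ℝ ψ x (LinearMap.single ℝ (fun _ : Fin N => Space d) i h) = 0 from
        hg0 x fun hx' => hx (hsub hx'), mul_zero],
    setIntegral_eq_integral_of_forall_compl_eq_zero fun x hx => by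
      rw [hψ0 x fun hx' => hx (hsub hx'), mul_zero]] at hk
  have hint : Integrable fun x => ψ x • W k i x := by
    rw [← integrableOn_iff_integrable_of_support_subset (s := tsupport ψ)]
    · exact (hWI k).bdd_smul B₂ hψ.continuous.aestronglyMeasurable (Eventually.of_forall hB₂)
    · intro x hx
      by_contra hx'
      exact hx (by simp [hψ0 x hx'])
  rw [real_inner_comm, ← integral_inner hint]
  have e₁ : ∀ x, inner ℝ h (ψ x • W k i x) = inner ℝ (W k i x) h * ψ x := fun x => by
    rw [real_inner_smul_right, real_inner_comm, mul_comm]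
  simp only [e₁, smul_eq_mul]
  rw [← hk]
  exact integral_congr_ae (Eventually.of_forall fun x => mul_comm _ _)

/-- The gradient of a function in the domain of the closed form is unique. -/
theorem IsClosedGradient.ae_eq (hd : 1 ≤ d) (hβ : 0 < β) (hφ : IsPairPotential φ)
    (hBB : BoundedFromBelow φ) (hcont : ContinuousOn (fun x => (φ x).toReal) {0}ᶜ)
    (hΛ₀ : volume (box Λ N) ≠ 0) (hΛ : volume (box Λ N) ≠ ⊤) (hreg : IsRegularVolume Λ N)
    {u : (Fin N → Space d) → ℝ} {V V' : Fin N → (Fin N → Space d) → Space d}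
    (hV : IsClosedGradient β φ Λ N u V) (hV' : IsClosedGradient β φ Λ N u V') (i : Fin N) :
    V i =ᵐ[tupleGibbs β φ Λ N] V' i := by
  have := isProbabilityMeasure_tupleGibbs hβ hφ hBB hΛ₀ hΛ
  have hint : ∀ {f : (Fin N → Space d) → Space d}, MemLp f 2 (tupleGibbs β φ Λ N) →
      ∀ K ⊆ regularPart Λ N, IsCompact K → IntegrableOn f K := by
    intro f hf K hKs hK
    obtain ⟨C, hC, hKP⟩ := exists_volume_restrict_le hβ hφ hBB hcont hΛ₀ hΛ hK hKs
    exact ((hf.integrable (by norm_num)).smul_measure hC).mono_measure hKP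
  have hloc : LocallyIntegrableOn (fun x => V i x - V' i x) (regularPart Λ N) :=
    (locallyIntegrableOn_iff isOpen_regularPart.isLocallyClosed).2 fun K hKs hK =>
      (hint (hV.memLp_grad i) K hKs hK).sub (hint (hV'.memLp_grad i) K hKs hK)
  -- Fundamental lemma of the calculus of variations: both gradients have the same pairings with
  -- test functions on the regular part, since these are determined by `u`.
  have hae := isOpen_regularPart.ae_eq_zero_of_integral_contDiff_smul_eq_zero hloc
    fun ψ hψ hc hs => by
      have hψ0 : ∀ x ∉ tsupport ψ, ψ x = 0 := fun x hx => image_eq_zero_of_notMem_tsupport hx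
      obtain ⟨B, hB⟩ := hψ.continuous.bounded_above_of_compact_support hc
      have hI : ∀ {f : (Fin N → Space d) → Space d}, MemLp f 2 (tupleGibbs β φ Λ N) →
          Integrable fun x => ψ x • f x := by
        intro f hf
        rw [← integrableOn_iff_integrable_of_support_subset (s := tsupport ψ)]
        · exact (hint hf _ hs hc).bdd_smul B hψ.continuous.aestronglyMeasurable
            (Eventually.of_forall hB)
        · intro x hx
          by_contra hx'
          exact hx (by simp [hψ0 x hx'])
      simp only [smul_sub]
      rw [integral_sub (hI (hV.memLp_grad i)) (hI (hV'.memLp_grad i)), sub_eq_zero]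
      refine ext_inner_right ℝ fun h => neg_injective ?_
      rw [← hV.integral_eq hβ hφ hBB hcont hΛ₀ hΛ hreg i hψ hc hs h,
        ← hV'.integral_eq hβ hφ hBB hcont hΛ₀ hΛ hreg i hψ hc hs h]
  have hac : tupleGibbs β φ Λ N ≪ (volume : Measure (Fin N → Space d)) :=
    tupleGibbs_absolutelyContinuous.trans Measure.restrict_le_self.absolutelyContinuous
  filter_upwards [hac.ae_le hae, ae_mem_regularPart hd hreg] with x hx hmem
  exact sub_eq_zero.1 (hx hmem)

end Closability

/-! ### Cylinder functions and the finite volume form -/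

section Cylinder

variable {d : ℕ} {β : ℝ} {φ : Space d → EReal} {Λ : Set (Space d)} {N : ℕ}

namespace CylinderFunction

/-- The smooth function on `(ℝ^d)^N` that agrees with `F ∘ sym` away from the diagonals. -/
def tupleFun (F : CylinderFunction d) (N : ℕ) (x : Fin N → Space d) : ℝ :=
  F.g fun j => ∑ i, F.f j (x i)

/-- The gradient of `tupleFun` in the `i`-th variable. -/
def tupleGrad (F : CylinderFunction d) (N : ℕ) (i : Fin N) (x : Fin N → Space d) : Space d :=
  ∑ j, fderiv ℝ F.g (fun k => ∑ l, F.f k (x l)) (Pi.single j 1) • gradient (F.f j) (x i)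

theorem contDiff_sums (F : CylinderFunction d) (N : ℕ) :
    ContDiff ℝ ∞ fun (x : Fin N → Space d) (j : Fin F.n) => ∑ i, F.f j (x i) :=
  contDiff_pi.2 fun j => ContDiff.sum fun i _ => (F.contDiff_f j).comp (contDiff_apply ℝ _ i)

theorem contDiff_tupleFun (F : CylinderFunction d) (N : ℕ) : ContDiff ℝ ∞ (F.tupleFun N) :=
  F.contDiff_g.comp (F.contDiff_sums N)

theorem continuous_tupleGrad (F : CylinderFunction d) (N : ℕ) (i : Fin N) :
    Continuous (F.tupleGrad N i) :=
  continuous_finsetSum _ fun j _ => ((((F.contDiff_g.continuous_fderiv (by simp)).comp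
    (F.contDiff_sums N).continuous).clm_apply continuous_const).smul
      ((continuous_gradient (F.contDiff_f j)).comp (continuous_apply i)))

theorem fderiv_tupleFun (F : CylinderFunction d) (i : Fin N) (x : Fin N → Space d) (h : Space d) :
    fderiv ℝ (F.tupleFun N) x (LinearMap.single ℝ (fun _ : Fin N => Space d) i h) =
      inner ℝ (F.tupleGrad N i x) h := by
  have hf : ∀ j y, HasFDerivAt (F.f j) (fderiv ℝ (F.f j) y) y := fun j y =>
    ((F.contDiff_f j).differentiable (by simp) y).hasFDerivAt
  have hS : HasFDerivAt (fun (x : Fin N → Space d) (j : Fin F.n) => ∑ i, F.f j (x i))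
      (ContinuousLinearMap.pi fun j => ∑ l, (fderiv ℝ (F.f j) (x l)).comp
        (ContinuousLinearMap.proj l)) x :=
    hasFDerivAt_pi.2 fun j => HasFDerivAt.fun_sum fun l _ =>
      (hf j (x l)).comp x (hasFDerivAt_apply l x)
  have hg : HasFDerivAt F.g (fderiv ℝ F.g fun j => ∑ l, F.f j (x l)) (fun j => ∑ l, F.f j (x l)) :=
    (F.contDiff_g.differentiable (by simp) _).hasFDerivAt
  have hcomp := (hg.comp x hS).fderiv
  change fderiv ℝ (F.tupleFun N) x = _ at hcomp
  rw [hcomp, ContinuousLinearMap.comp_apply]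
  have hvec : (ContinuousLinearMap.pi fun j => ∑ l, (fderiv ℝ (F.f j) (x l)).comp
      (ContinuousLinearMap.proj l)) (LinearMap.single ℝ (fun _ : Fin N => Space d) i h) =
        ∑ j, (fderiv ℝ (F.f j) (x i) h) • (Pi.single j 1 : Fin F.n → ℝ) := by
    funext j
    simp only [ContinuousLinearMap.pi_apply, _root_.sum_apply,
      ContinuousLinearMap.comp_apply, ContinuousLinearMap.proj_apply, LinearMap.single_apply,
      Finset.sum_apply, Pi.smul_apply, smul_eq_mul]
    rw [Finset.sum_eq_single_of_mem i (Finset.mem_univ i), Finset.sum_eq_single_of_mem j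
      (Finset.mem_univ j)]
    · simp
    · intro k _ hk
      simp [hk.symm]
    · intro l _ hl
      simp [hl]
  rw [hvec, map_sum, tupleGrad, sum_inner]
  refine Finset.sum_congr rfl fun j _ => ?_
  rw [map_smul, real_inner_smul_left, inner_gradient_left, smul_eq_mul, mul_comm]

/-- The function is smooth on the whole space and test functions vanish off `U`, so ordinary
integration by parts on the whole space applies without boundary terms. -/
theorem hasWeakGradientAlong_tupleFun (F : CylinderFunction d) (i : Fin N)
    {U : Set (Fin N → Space d)} :
    HasWeakGradientAlong (LinearMap.single ℝ (fun _ : Fin N => Space d) i) U (F.tupleFun N)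
      (F.tupleGrad N i) where
  locallyIntegrable := (F.contDiff_tupleFun N).continuous.locallyIntegrable.locallyIntegrableOn U
  locallyIntegrable_grad := (F.continuous_tupleGrad N i).locallyIntegrable.locallyIntegrableOn U
  integral_eq := by
    intro ψ hψ hc hs h
    set e := LinearMap.single ℝ (fun _ : Fin N => Space d) i h with he
    have hψ0 : ∀ x ∉ U, ψ x = 0 := fun x hx =>
      image_eq_zero_of_notMem_tsupport fun hx' => hx (hs hx')
    have hdψ0 : ∀ x ∉ U, fderiv ℝ ψ x e = 0 := by
      intro x hx
      have : fderiv ℝ ψ x = 0 := by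
        by_contra hne
        exact hx (hs (tsupport_fderiv_subset ℝ (subset_tsupport _ hne)))
      simp [this]
    rw [setIntegral_eq_integral_of_forall_compl_eq_zero fun x hx => by rw [hdψ0 x hx, mul_zero],
      setIntegral_eq_integral_of_forall_compl_eq_zero fun x hx => by rw [hψ0 x hx, mul_zero]]
    have hu := F.contDiff_tupleFun N
    have hdψ : Continuous fun x => fderiv ℝ ψ x e :=
      (hψ.continuous_fderiv (by simp)).clm_apply continuous_const
    have hdψc : HasCompactSupport fun x => fderiv ℝ ψ x e :=
      hc.fderiv_apply (𝕜 := ℝ) e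
    simp only [← F.fderiv_tupleFun i]
    refine integral_mul_fderiv_eq_neg_fderiv_mul_of_integrable ?_ ?_ ?_
      (fun x _ => hu.differentiable (by simp) x) fun x _ => hψ.differentiable (by simp) x
    · exact (((hu.continuous_fderiv (by simp)).clm_apply continuous_const).mul
        hψ.continuous).integrable_of_hasCompactSupport hc.mul_left
    · exact (hu.continuous.mul hdψ).integrable_of_hasCompactSupport hdψc.mul_left
    · exact (hu.continuous.mul hψ.continuous).integrable_of_hasCompactSupport hc.mul_left

theorem toFun_sym (F : CylinderFunction d) {x : Fin N → Space d} (hx : Function.Injective x) :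
    F.toFun (sym x) = F.tupleFun N x := by
  simp only [toFun, tupleFun, pairing_sym _ hx]

theorem grad_sym (F : CylinderFunction d) {x : Fin N → Space d} (hx : Function.Injective x)
    (i : Fin N) : F.grad (sym x) (x i) = F.tupleGrad N i x := by
  simp only [grad, tupleGrad, pairing_sym _ hx]

theorem memLp_of_continuous {E : Type*} [NormedAddCommGroup E] [IsProbabilityMeasure (tupleGibbs β φ Λ N)]
    [SecondCountableTopology E] (hd : 1 ≤ d) (hreg : IsRegularVolume Λ N)
    {f : (Fin N → Space d) → E} (hf : Continuous f) : MemLp f 2 (tupleGibbs β φ Λ N) := by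
  obtain ⟨C, hC⟩ := hreg.isCompact_box.exists_bound_of_continuousOn hf.continuousOn
  refine MemLp.of_bound hf.aestronglyMeasurable C ?_
  filter_upwards [ae_mem_regularPart hd hreg] with x hx
  exact hC x (regularPart_subset_box hx)

/-- `F ∘ sym` may jump at the diagonals, but it agrees almost everywhere with the smooth `tupleFun`,
which lies in the core; the constant sequence serves as approximation. -/
theorem isClosedGradient (F : CylinderFunction d) [IsProbabilityMeasure (tupleGibbs β φ Λ N)]
    (hd : 1 ≤ d) (hreg : IsRegularVolume Λ N) :
    IsClosedGradient β φ Λ N (F.toFun ∘ sym) (F.tupleGrad N) := by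
  have hae : F.tupleFun N =ᵐ[tupleGibbs β φ Λ N] F.toFun ∘ sym :=
    (ae_injective_tupleGibbs hd).mono fun x hx => (F.toFun_sym hx).symm
  have hu := (F.contDiff_tupleFun N).continuous
  have hV : ∀ i, MemLp (F.tupleGrad N i) 2 (tupleGibbs β φ Λ N) := fun i =>
    memLp_of_continuous hd hreg (F.continuous_tupleGrad N i)
  refine ⟨(memLp_of_continuous hd hreg hu).ae_eq hae, hV, fun _ => F.tupleFun N,
    fun _ => F.tupleGrad N, fun _ => ⟨hu.continuousOn, fun i => F.hasWeakGradientAlong_tupleFun i,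
      hV⟩, ?_, fun i => ?_⟩
  · have h0 : eLpNorm (F.tupleFun N - F.toFun ∘ sym) 2 (tupleGibbs β φ Λ N) = 0 := by
      rw [eLpNorm_congr_ae (g := 0), eLpNorm_zero]
      exact hae.mono fun x hx => by simp [hx]
    simp only [h0]
    exact tendsto_const_nhds
  · simp

theorem finiteVolumeDomain (F : CylinderFunction d) [IsProbabilityMeasure (tupleGibbs β φ Λ N)]
    (hd : 1 ≤ d) (hreg : IsRegularVolume Λ N) : FiniteVolumeDomain β φ Λ N F.toFun :=
  ⟨(memLp_map_measure_iff F.continuous_toFun.aestronglyMeasurable (aemeasurable_sym hd)).2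
    (F.isClosedGradient hd hreg).memLp, _, F.isClosedGradient hd hreg⟩

end CylinderFunction

/-- Uniqueness identifies the chosen gradients with the explicit ones. On injective tuples the sum
over labels of their inner products is the sum over the points of the configuration. -/
theorem finiteVolumeForm_eq_integral (hd : 1 ≤ d) (hβ : 0 < β) (hφ : IsPairPotential φ)
    (hBB : BoundedFromBelow φ) (hcont : ContinuousOn (fun x => (φ x).toReal) {0}ᶜ)
    (hΛ₀ : volume (box Λ N) ≠ 0) (hΛ : volume (box Λ N) ≠ ⊤) (hreg : IsRegularVolume Λ N)
    (F G : CylinderFunction d) :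
    finiteVolumeForm β φ Λ N F.toFun G.toFun =
      ∫ γ, squareField F G γ ∂(canonicalGibbs β φ Λ N) := by
  have := isProbabilityMeasure_tupleGibbs hβ hφ hBB hΛ₀ hΛ
  have hgrad : ∀ (H : CylinderFunction d) (i : Fin N),
      closedGradient β φ Λ N (H.toFun ∘ sym) i =ᵐ[tupleGibbs β φ Λ N] H.tupleGrad N i := by
    intro H i
    have hdom : TupleFormDomain β φ Λ N (H.toFun ∘ sym) := ⟨_, H.isClosedGradient hd hreg⟩
    rw [closedGradient, dif_pos hdom]
    exact hdom.choose_spec.ae_eq hd hβ hφ hBB hcont hΛ₀ hΛ hreg (H.isClosedGradient hd hreg) i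
  have hint : ∀ i : Fin N, Integrable (fun x => inner ℝ (F.tupleGrad N i x) (G.tupleGrad N i x))
      (tupleGibbs β φ Λ N) := fun i =>
    (CylinderFunction.memLp_of_continuous hd hreg
      ((F.continuous_tupleGrad N i).inner (G.continuous_tupleGrad N i))).integrable (by norm_num)
  calc finiteVolumeForm β φ Λ N F.toFun G.toFun
      = ∑ i, ∫ x, inner ℝ (F.tupleGrad N i x) (G.tupleGrad N i x) ∂(tupleGibbs β φ Λ N) := by
        rw [finiteVolumeForm, tupleForm]
        refine Finset.sum_congr rfl fun i _ => integral_congr_ae ?_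
        filter_upwards [hgrad F i, hgrad G i] with x h₁ h₂
        rw [h₁, h₂]
    _ = ∫ x, ∑ i, inner ℝ (F.tupleGrad N i x) (G.tupleGrad N i x) ∂(tupleGibbs β φ Λ N) :=
        (integral_finsetSum _ fun i _ => hint i).symm
    _ = ∫ x, squareField F G (sym x) ∂(tupleGibbs β φ Λ N) := by
        refine integral_congr_ae ((ae_injective_tupleGibbs hd).mono fun x hx => ?_)
        simp only [squareField, pairing_sym _ hx, CylinderFunction.grad_sym _ hx]
    _ = _ := (integral_map (aemeasurable_sym hd)
        (continuous_squareField F G).aestronglyMeasurable).symm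

end Cylinder

/-! ### Weak convergence and unbounded continuous functions -/

section WeakConvergence

variable {d : ℕ}

/-- The truncation of a continuous function at level `M`. -/
def truncation (H : Config d → ℝ) (hH : Continuous H) (M : ℝ) (hM : 0 ≤ M) :
    BoundedContinuousFunction (Config d) ℝ :=
  BoundedContinuousFunction.ofNormedAddCommGroup (fun γ => max (min (H γ) M) (-M))
    ((hH.min continuous_const).max continuous_const) M fun γ => by
      rw [Real.norm_eq_abs, abs_le]
      exact ⟨le_max_right _ _, max_le (min_le_right _ _) (by linarith)⟩

/-- The difference vanishes for `|t| ≤ M`, and otherwise it is at most `|t| ≤ t² / M`. So a second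
moment bound controls truncation errors uniformly. -/
theorem abs_sub_truncation_le (t : ℝ) {M : ℝ} (hM : 0 < M) :
    |t - max (min t M) (-M)| ≤ t ^ 2 / M := by
  rw [le_div_iff₀ hM]
  rcases le_total t M with h₁ | h₁
  · rw [min_eq_left h₁]
    rcases le_total t (-M) with h₂ | h₂
    · rw [max_eq_right h₂, abs_of_nonpos (by linarith)]
      nlinarith
    · rw [max_eq_left h₂, sub_self, abs_zero, zero_mul]
      positivity
  · rw [min_eq_right h₁, max_eq_left (by linarith), abs_of_nonneg (by linarith)]
    nlinarith

theorem abs_integral_sub_truncation_le {P : Measure (Config d)} [IsProbabilityMeasure P]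
    {H : Config d → ℝ} (hH : Continuous H) (hL2 : MemLp H 2 P) {C : ℝ}
    (hC : ∫ γ, H γ ^ 2 ∂P ≤ C) {M : ℝ} (hM : 0 < M) :
    |∫ γ, H γ ∂P - ∫ γ, truncation H hH M hM.le γ ∂P| ≤ C / M := by
  have hsq : Integrable (fun γ => H γ ^ 2) P := hL2.integrable_sq
  rw [← integral_sub (hL2.integrable (by norm_num)) ((truncation H hH M hM.le).integrable P)]
  refine abs_integral_le_integral_abs.trans ?_
  calc _ ≤ ∫ γ, H γ ^ 2 / M ∂P := by
        refine integral_mono_of_nonneg (Eventually.of_forall fun γ => abs_nonneg _)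
          (hsq.div_const M) (Eventually.of_forall fun γ => abs_sub_truncation_le (H γ) hM)
    _ = (∫ γ, H γ ^ 2 ∂P) / M := integral_div _ _
    _ ≤ C / M := div_le_div_of_nonneg_right hC hM.le

theorem memLp_two_of_lintegral_le {P : Measure (Config d)} {H : Config d → ℝ} (hH : Continuous H)
    {C : ℝ} (hC0 : 0 ≤ C) (hC : ∫⁻ γ, ENNReal.ofReal (H γ ^ 2) ∂P ≤ ENNReal.ofReal C) :
    MemLp H 2 P ∧ ∫ γ, H γ ^ 2 ∂P ≤ C := by
  have hm := (hH.pow 2).aestronglyMeasurable (μ := P)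
  refine ⟨(memLp_two_iff_integrable_sq hH.aestronglyMeasurable).2 ⟨hm, ?_⟩, ?_⟩
  · rw [hasFiniteIntegral_iff_ofReal (Eventually.of_forall fun γ => sq_nonneg _)]
    exact hC.trans_lt ENNReal.ofReal_lt_top
  · rw [integral_eq_lintegral_of_nonneg_ae (Eventually.of_forall fun γ => sq_nonneg _) hm]
    exact ENNReal.toReal_le_of_le_ofReal hC0 hC

/-- A uniform bound on second moments is inherited by the weak limit. -/
theorem ConvergesWeakly.lintegral_sq_le {ν : ℕ → Measure (Config d)} {μ : Measure (Config d)}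
    [∀ n, IsProbabilityMeasure (ν n)] [IsProbabilityMeasure μ] (h : ConvergesWeakly ν μ)
    {H : Config d → ℝ} (hH : Continuous H) {C : ℝ} (hC0 : 0 ≤ C)
    (hC : ∀ n, ∫⁻ γ, ENNReal.ofReal (H γ ^ 2) ∂(ν n) ≤ ENNReal.ofReal C) :
    ∫⁻ γ, ENNReal.ofReal (H γ ^ 2) ∂μ ≤ ENNReal.ofReal C := by
  have hsq := hH.pow 2
  have hbound : ∀ m : ℕ, ∫⁻ γ, ENNReal.ofReal (truncation _ hsq m (Nat.cast_nonneg m) γ) ∂μ ≤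
      ENNReal.ofReal C := by
    intro m
    set T := truncation _ hsq m (Nat.cast_nonneg m) with hT
    have hT0 : ∀ γ, 0 ≤ T γ := fun γ =>
      le_max_of_le_left (le_min (sq_nonneg _) (Nat.cast_nonneg m))
    have hTle : ∀ γ, T γ ≤ H γ ^ 2 := fun γ => max_le (min_le_left _ _)
      ((neg_nonpos.2 (Nat.cast_nonneg m)).trans (sq_nonneg _))
    rw [← ofReal_integral_eq_lintegral_ofReal (T.integrable μ) (Eventually.of_forall hT0)]
    refine ENNReal.ofReal_le_ofReal (le_of_tendsto' (h T) fun n => ?_)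
    obtain ⟨hL2, hle⟩ := memLp_two_of_lintegral_le hH hC0 (hC n)
    exact (integral_mono (T.integrable _) hL2.integrable_sq hTle).trans hle
  have hlim : ∀ γ, liminf (fun m : ℕ =>
      ENNReal.ofReal (truncation _ hsq m (Nat.cast_nonneg m) γ)) atTop = ENNReal.ofReal (H γ ^ 2) := by
    intro γ
    refine Tendsto.liminf_eq (tendsto_const_nhds.congr' ?_)
    obtain ⟨m₀, hm₀⟩ := exists_nat_ge (H γ ^ 2)
    filter_upwards [eventually_ge_atTop m₀] with m hm
    have hm' : H γ ^ 2 ≤ m := hm₀.trans (by exact_mod_cast hm)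
    change _ = ENNReal.ofReal (max (min (H γ ^ 2) m) (-m))
    rw [min_eq_left hm', max_eq_left ((neg_nonpos.2 (Nat.cast_nonneg m)).trans (sq_nonneg _))]
  calc ∫⁻ γ, ENNReal.ofReal (H γ ^ 2) ∂μ = ∫⁻ γ, liminf (fun m : ℕ =>
        ENNReal.ofReal (truncation _ hsq m (Nat.cast_nonneg m) γ)) atTop ∂μ :=
        lintegral_congr fun γ => (hlim γ).symm
    _ ≤ liminf (fun m : ℕ => ∫⁻ γ,
        ENNReal.ofReal (truncation _ hsq m (Nat.cast_nonneg m) γ) ∂μ) atTop :=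
        lintegral_liminf_le fun m =>
          (truncation _ hsq m (Nat.cast_nonneg m)).continuous.measurable.ennreal_ofReal
    _ ≤ _ := liminf_le_of_frequently_le' (Frequently.of_forall hbound)

/-- Integrals of continuous functions with uniformly bounded second moments converge along weakly
convergent sequences. -/
theorem ConvergesWeakly.tendsto_integral_of_sq_bound {ν : ℕ → Measure (Config d)}
    {μ : Measure (Config d)} [∀ n, IsProbabilityMeasure (ν n)] [IsProbabilityMeasure μ]
    (h : ConvergesWeakly ν μ) {H : Config d → ℝ} (hH : Continuous H) {C : ℝ} (hC0 : 0 ≤ C)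
    (hC : ∀ n, ∫⁻ γ, ENNReal.ofReal (H γ ^ 2) ∂(ν n) ≤ ENNReal.ofReal C) :
    Integrable H μ ∧ Tendsto (fun n => ∫ γ, H γ ∂(ν n)) atTop (𝓝 (∫ γ, H γ ∂μ)) := by
  obtain ⟨hL2, hle⟩ := memLp_two_of_lintegral_le hH hC0 (h.lintegral_sq_le hH hC0 hC)
  refine ⟨hL2.integrable (by norm_num), Metric.tendsto_atTop.2 fun ε hε => ?_⟩
  -- This level makes the truncation error `C / M` smaller than `ε / 3`, both along the sequence and
  -- for the limit; weak convergence of the truncated integrals supplies the last third.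
  set M := 3 * (C + 1) / ε with hMdef
  have hM : 0 < M := by positivity
  have hCM : C / M < ε / 3 := by
    rw [div_lt_iff₀ hM, hMdef]
    field_simp
    linarith
  obtain ⟨n₀, hn₀⟩ := Metric.tendsto_atTop.1 (h (truncation H hH M hM.le)) (ε / 3) (by positivity)
  refine ⟨n₀, fun n hn => ?_⟩
  obtain ⟨hL2n, hlen⟩ := memLp_two_of_lintegral_le hH hC0 (hC n)
  have h₁ := (abs_le.1 (abs_integral_sub_truncation_le hH hL2n hlen hM))
  have h₂ := (abs_le.1 (abs_integral_sub_truncation_le hH hL2 hle hM))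
  have h₃ := hn₀ n hn
  rw [Real.dist_eq, abs_lt] at h₃ ⊢
  constructor <;> linarith [h₁.1, h₁.2, h₂.1, h₂.2, h₃.1, h₃.2]

end WeakConvergence

/-- The square field of cylinder functions has uniformly bounded second moments under the canonical
Gibbs measures. -/
theorem exists_squareField_moment_bound {d : ℕ} (hd : 1 ≤ d) {β : ℝ} (hβ : 0 < β)
    {φ : Space d → EReal} (hφ : IsPairPotential φ) (hRP : Repulsive φ) (hT : Tempered φ)
    (hBB : BoundedFromBelow φ) (hcont : ContinuousOn (fun x => (φ x).toReal) {0}ᶜ) {ρ : ℝ}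
    {Λ : ℕ → Set (Space d)} (hΛ : IsVolumeSequence ρ Λ) (F G : CylinderFunction d) :
    ∃ C : ℝ, 0 ≤ C ∧ ∀ N, 1 ≤ N →
      ∫⁻ γ, ENNReal.ofReal (squareField F G γ ^ 2) ∂(canonicalGibbs β φ (Λ N) N) ≤
        ENNReal.ofReal C := by
  obtain ⟨s, c, hs, hc, hbound⟩ := exists_squareField_sym_bound F G
  obtain ⟨C, hC0, hC⟩ := exists_second_moment_bound hd hβ hφ hRP hT hBB hcont hΛ hs
  refine ⟨c ^ 2 * C, by positivity, fun N hN => ?_⟩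
  have hm : Measurable fun γ => ENNReal.ofReal (squareField F G γ ^ 2) :=
    ((continuous_squareField F G).pow 2).measurable.ennreal_ofReal
  rw [canonicalGibbs, lintegral_map' hm.aemeasurable (aemeasurable_sym hd)]
  calc _ ≤ ∫⁻ x, ENNReal.ofReal (c ^ 2) * ENNReal.ofReal (cellCount (cellIndex s ∘ x) 0 ^ 2)
        ∂(tupleGibbs β φ (Λ N) N) := by
        refine lintegral_mono_ae ((ae_injective_tupleGibbs hd).mono fun x hx => ?_)
        rw [← ENNReal.ofReal_mul (sq_nonneg c), ← mul_pow, ← sq_abs]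
        exact ENNReal.ofReal_le_ofReal (pow_le_pow_left₀ (abs_nonneg _) (hbound N x hx) 2)
    _ = ENNReal.ofReal (c ^ 2) * ∫⁻ x, ENNReal.ofReal (cellCount (cellIndex s ∘ x) 0 ^ 2)
        ∂(tupleGibbs β φ (Λ N) N) := lintegral_const_mul' _ _ ENNReal.ofReal_ne_top
    _ ≤ ENNReal.ofReal (c ^ 2) * ENNReal.ofReal C := by gcongr; exact hC N hN
    _ = _ := (ENNReal.ofReal_mul (sq_nonneg c)).symm

end NVLimit

end

/-! ### Convergence of the finite volume Dirichlet forms -/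

theorem proposition5p12 {d : ℕ} (hd : 1 ≤ d) {β : ℝ} (hβ : 0 < β)
    {φ : NVLimit.Space d → EReal} (hφ : NVLimit.IsPairPotential φ)
    (hRP : NVLimit.Repulsive φ) (hT : NVLimit.Tempered φ) (hBB : NVLimit.BoundedFromBelow φ)
    (hD : NVLimit.IsDifferentiablePotential β φ)
    {ρ : ℝ} {Λ : ℕ → Set (NVLimit.Space d)} (hΛ : NVLimit.IsVolumeSequence ρ Λ)
    (hreg : ∀ N : ℕ, 1 ≤ N → NVLimit.IsRegularVolume (Λ N) N)
    {μ : MeasureTheory.Measure (NVLimit.Config d)} [MeasureTheory.IsProbabilityMeasure μ]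
    {N : ℕ → ℕ} (hN_pos : ∀ n, 1 ≤ N n) (hN : StrictMono N)
    (hμ : NVLimit.ConvergesWeakly (fun n => NVLimit.canonicalGibbs β φ (Λ (N n)) (N n)) μ)
    (F G : NVLimit.CylinderFunction d) :
    (∀ n, NVLimit.FiniteVolumeDomain β φ (Λ (N n)) (N n) F.toFun ∧
      NVLimit.FiniteVolumeDomain β φ (Λ (N n)) (N n) G.toFun) ∧
    MeasureTheory.Integrable (NVLimit.squareField F G) μ ∧
    Filter.Tendsto
      (fun n => NVLimit.finiteVolumeForm β φ (Λ (N n)) (N n) F.toFun G.toFun)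
      Filter.atTop (nhds (NVLimit.infiniteVolumeForm μ F G)) := by
  have hcont := hD.contDiffOn.continuousOn
  have hvol := fun n => NVLimit.box_volume hΛ (hN_pos n)
  have hprob : ∀ n, MeasureTheory.IsProbabilityMeasure
      (NVLimit.tupleGibbs β φ (Λ (N n)) (N n)) := fun n =>
    NVLimit.isProbabilityMeasure_tupleGibbs hβ hφ hBB (hvol n).1 (hvol n).2
  have hprob' : ∀ n, MeasureTheory.IsProbabilityMeasure
      (NVLimit.canonicalGibbs β φ (Λ (N n)) (N n)) := fun n =>
    MeasureTheory.Measure.isProbabilityMeasure_map (NVLimit.aemeasurable_sym hd)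
  obtain ⟨C, hC0, hC⟩ :=
    NVLimit.exists_squareField_moment_bound hd hβ hφ hRP hT hBB hcont hΛ F G
  -- The uniform second moment bound gives both absolute convergence of the limit integral and
  -- convergence of the integrals; it remains to recognize these integrals as the finite volume
  -- forms.
  obtain ⟨hint, hlim⟩ := hμ.tendsto_integral_of_sq_bound (NVLimit.continuous_squareField F G) hC0
    fun n => hC (N n) (hN_pos n)
  refine ⟨fun n => ⟨F.finiteVolumeDomain hd (hreg _ (hN_pos n)),
    G.finiteVolumeDomain hd (hreg _ (hN_pos n))⟩, hint, hlim.congr fun n => ?_⟩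
  exact (NVLimit.finiteVolumeForm_eq_integral hd hβ hφ hBB hcont (hvol n).1 (hvol n).2
    (hreg _ (hN_pos n)) F G).symm
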